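/- A map is a connected graph (multiple edges allowed) embedded in the oriented sphere, considered up to orientation-preserving homeomorphism. It is bicolored if its vertices are colored black and white so that every edge joins a black and a white vertex, and 4-regular if every vertex has valency 4. A Hamiltonian cycle on a 4-regular bicolored planar map is a single closed self-avoiding loop made of edges of the map and visiting every vertex; its edges are called visited. It is rigid if at every vertex the two unvisited edges lie on different sides of the loop (one on each side). For $N\ge 1$ consider the finite set of all 4-regular bicolored planar maps with $2N$ vertices equipped with a rigid Hamiltonian cycle and a marked visited edge, up to isomorphism (equivalently, meandric systems of size $N$); let $z_N$ be its cardinality. Label the vertices $1,\dots,2N$ in their order along the cycle, from the black endpoint of the marked edge to its white endpoint, and let the two halves of the cycle consist of the vertices $1,\dots,N$ and $N+1,\dots,2N$ respectively. A contact link is an unvisited edge joining a vertex of the first half to a vertex of the second half. Let $y_N$ be the total number of contact links, summed over all these configurations, and let $k_N=y_N/z_N$ be the average number of contact links. Then for every integer $M\ge 1$ $$k_{2M}=\frac{2\binom{2M}{M}^2}{\frac{1}{2M+1}\binom{4M}{2M}}-2,\qquad k_{2M-1}=\frac{2\binom{2M}{M}\binom{2M-2}{M-1}}{\frac{1}{2M}\binom{4M-2}{2M-1}}-2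 .$$ Consequently, as $N\to\infty$, $$k_N\sim 4\sqrt{N/\pi},$$ so that the exponent $\nu$ defined by $k_N\sim\varrho N^{\nu}$ (for some constant $\varrho>0$) exists, is unique, and equals $1/2$. -/

import Mathlib

open Filter Topology Asymptotics

/-- A combinatorial map with set of half-edges `D`, encoding a graph (loops and multiple edges
allowed) drawn on an oriented surface. `rot` sends a half-edge to the next one counterclockwise
around its vertex; `flip` exchanges the two half-edges of every edge. Vertices, edges and faces are
the orbits of `rot`, `flip` and `rot * flip`. -/
structure CombinatorialMap (D : Type*) where
  rot : Equiv.Perm D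
  flip : Equiv.Perm D
  flip_flip : ∀ d, flip (flip d) = d
  flip_ne : ∀ d, flip d ≠ d

namespace CombinatorialMap

variable {D : Type*} (m : CombinatorialMap D)

/-- Two half-edges are incident to the same vertex. -/
def SameVertex (d d' : D) : Prop := m.rot.SameCycle d d'

/-- The number of orbits of a permutation (fixed points count as orbits). -/
noncomputable def orbitCount (p : Equiv.Perm D) : ℕ :=
  Nat.card (Quotient (Equiv.Perm.SameCycle.setoid p))

/-- The map is connected: `rot` and `flip` act transitively on half-edges. -/
def IsConnected : Prop :=
  ∀ d d' : D, ∃ g ∈ Subgroup.closure ({m.rot, m.flip} : Set (Equiv.Perm D)), g d = d'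

/-- A planar map: a connected map of genus zero, that is, with `V - E + F = 2`. -/
def IsPlanar : Prop :=
  m.IsConnected ∧
    (orbitCount m.rot : ℤ) - orbitCount m.flip + orbitCount (m.rot * m.flip) = 2

/-- All vertices have valency `p`. -/
def IsRegular (p : ℕ) : Prop := ∀ d, {x | m.SameVertex d x}.ncard = p

/-- `B` is the set of half-edges incident to the black vertices of a proper black/white colouring
of the vertices. -/
def IsBicoloring (B : Set D) : Prop :=
  (∀ d, m.rot d ∈ B ↔ d ∈ B) ∧ ∀ d, m.flip d ∈ B ↔ d ∉ B

/-- `C` is the set of half-edges of a Hamiltonian cycle: it is a union of edges, every vertex is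
incident to exactly two half-edges of `C`, and the graph formed by all the vertices and by the edges
in `C` is connected (a single loop visits all the vertices). -/
def IsHamiltonianCycle (C : Set D) : Prop :=
  (∀ d, m.flip d ∈ C ↔ d ∈ C) ∧
  (∀ d, {x | m.SameVertex d x ∧ x ∈ C}.ncard = 2) ∧
  ∀ d d', Relation.EqvGen (fun x y => m.SameVertex x y ∨ (x ∈ C ∧ y = m.flip x)) d d'

/-- Rigidity of a Hamiltonian cycle on a 4-regular map: turning around a vertex from either of the
two visited half-edges, one meets exactly one unvisited half-edge before the other visited one. -/
def IsRigid (C : Set D) : Prop := ∀ d ∈ C, m.rot d ∉ C ∧ m.rot (m.rot d) ∈ C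

end CombinatorialMap

/-- A rigid Hamiltonian cycle with a marked visited edge on a 4-regular bicolored planar map with
`2 * N` vertices, whose `4 * (2 * N)` half-edges are labelled. The marked edge is given by its
half-edge `root` at its black end. -/
structure RigidHamiltonianMap (N : ℕ) extends CombinatorialMap (Fin (4 * (2 * N))) where
  isPlanar : toCombinatorialMap.IsPlanar
  isRegular : toCombinatorialMap.IsRegular 4
  black : Set (Fin (4 * (2 * N)))
  isBicoloring : toCombinatorialMap.IsBicoloring black
  cycle : Set (Fin (4 * (2 * N)))
  isHamiltonianCycle : toCombinatorialMap.IsHamiltonianCycle cycle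
  isRigid : toCombinatorialMap.IsRigid cycle
  root : Fin (4 * (2 * N))
  root_mem_cycle : root ∈ cycle
  root_mem_black : root ∈ black

namespace RigidHamiltonianMap

variable {N : ℕ}

/-- Isomorphism: a relabelling of the half-edges preserving the whole structure. -/
def Iso (X Y : RigidHamiltonianMap N) : Prop :=
  ∃ f : Equiv.Perm (Fin (4 * (2 * N))),
    (∀ d, f (X.rot d) = Y.rot (f d)) ∧ (∀ d, f (X.flip d) = Y.flip (f d)) ∧
    (∀ d, f d ∈ Y.black ↔ d ∈ X.black) ∧ (∀ d, f d ∈ Y.cycle ↔ d ∈ X.cycle) ∧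
    f X.root = Y.root

/-- The cycle is followed from the black end of the marked edge, away from that edge. The vertices
met are numbered `0, …, 2 * N - 1`, and `X.entry i` is the half-edge through which the cycle enters
vertex number `i` (it leaves that vertex through the opposite half-edge). -/
def entry (X : RigidHamiltonianMap N) (i : ℕ) : Fin (4 * (2 * N)) :=
  ((fun d => X.flip (X.rot (X.rot d)))^[i]) X.root

/-- Half-edges incident to the first `N` vertices along the cycle. -/
def firstHalf (X : RigidHamiltonianMap N) : Set (Fin (4 * (2 * N))) :=
  {d | ∃ i < N, X.SameVertex (X.entry i) d}

/-- Half-edges incident to the last `N` vertices along the cycle. -/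
def secondHalf (X : RigidHamiltonianMap N) : Set (Fin (4 * (2 * N))) :=
  {d | ∃ i, N ≤ i ∧ i < 2 * N ∧ X.SameVertex (X.entry i) d}

/-- The number of contact links: unvisited edges between a vertex of the first half and a vertex of
the second half of the cycle. Each one is counted through its half-edge in the first half. -/
noncomputable def contacts (X : RigidHamiltonianMap N) : ℕ :=
  {d | d ∉ X.cycle ∧ d ∈ X.firstHalf ∧ X.flip d ∈ X.secondHalf}.ncard

theorem Iso.refl (X : RigidHamiltonianMap N) : X.Iso X :=
  ⟨1, by simp⟩

theorem Iso.symm {X Y : RigidHamiltonianMap N} (h : X.Iso Y) : Y.Iso X := by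
  obtain ⟨f, h1, h2, h3, h4, h5⟩ := h
  refine ⟨f.symm, fun d => ?_, fun d => ?_, fun d => ?_, fun d => ?_, ?_⟩
  · rw [Equiv.symm_apply_eq, h1, Equiv.apply_symm_apply]
  · rw [Equiv.symm_apply_eq, h2, Equiv.apply_symm_apply]
  · rw [← h3, Equiv.apply_symm_apply]
  · rw [← h4, Equiv.apply_symm_apply]
  · rw [Equiv.symm_apply_eq, h5]

theorem Iso.trans {X Y Z : RigidHamiltonianMap N} (h : X.Iso Y) (h' : Y.Iso Z) : X.Iso Z := by
  obtain ⟨f, h1, h2, h3, h4, h5⟩ := h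
  obtain ⟨g, k1, k2, k3, k4, k5⟩ := h'
  refine ⟨f.trans g, fun d => ?_, fun d => ?_, fun d => ?_, fun d => ?_, ?_⟩
  · simp [h1, k1]
  · simp [h2, k2]
  · simp [h3, k3]
  · simp [h4, k4]
  · simp [h5, k5]

theorem Iso.contacts_eq {X Y : RigidHamiltonianMap N} (h : X.Iso Y) :
    X.contacts = Y.contacts := by
  obtain ⟨f, h1, h2, h3, h4, h5⟩ := h
  have hentry : ∀ i, f (X.entry i) = Y.entry i := by
    intro i
    induction i with
    | zero => exact h5
    | succ i ih =>
      simp only [entry, Function.iterate_succ_apply'] at ih ⊢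
      rw [h2, h1, h1, ih]
  have hconj : Y.rot = f * X.rot * f⁻¹ := by
    ext d
    simp [h1]
  have hsame : ∀ a b, Y.SameVertex (f a) (f b) ↔ X.SameVertex a b := by
    intro a b
    simp [CombinatorialMap.SameVertex, hconj, Equiv.Perm.sameCycle_conj]
  have hfirst : ∀ d, f d ∈ Y.firstHalf ↔ d ∈ X.firstHalf := by
    intro d
    simp only [firstHalf, Set.mem_ofPred_eq, ← hentry, hsame]
  have hsecond : ∀ d, f d ∈ Y.secondHalf ↔ d ∈ X.secondHalf := by
    intro d
    simp only [secondHalf, Set.mem_ofPred_eq, ← hentry, hsame]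
  unfold contacts
  rw [← Set.ncard_image_of_injective _ f.injective]
  congr 1
  ext d
  obtain ⟨d, rfl⟩ := f.surjective d
  rw [f.injective.mem_set_image]
  simp only [Set.mem_ofPred_eq, h4, hfirst, ← h2, hsecond]

/-- Equality up to isomorphism. -/
instance isoSetoid (N : ℕ) : Setoid (RigidHamiltonianMap N) where
  r := Iso
  iseqv := ⟨Iso.refl, Iso.symm, Iso.trans⟩

instance (N : ℕ) : Finite (RigidHamiltonianMap N) := by
  refine Finite.of_injective
    (fun X : RigidHamiltonianMap N => (X.rot, X.flip, X.black, X.cycle, X.root)) ?_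
  rintro ⟨⟨_, _, _, _⟩, _, _, _, _, _, _, _, _, _, _⟩ ⟨⟨_, _, _, _⟩, _, _, _, _, _, _, _, _, _, _⟩ h
  simp only [Prod.mk.injEq] at h
  obtain ⟨rfl, rfl, rfl, rfl, rfl⟩ := h
  rfl

end RigidHamiltonianMap

/-- Rigid Hamiltonian cycles with a marked visited edge on 4-regular bicolored planar maps with
`2 * N` vertices, up to isomorphism. -/
abbrev RigidConfig (N : ℕ) : Type := Quotient (RigidHamiltonianMap.isoSetoid N)

/-- The number of contact links of a configuration. -/
noncomputable def RigidConfig.contacts {N : ℕ} : RigidConfig N → ℕ :=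
  Quotient.lift RigidHamiltonianMap.contacts fun _ _ h => RigidHamiltonianMap.Iso.contacts_eq h

/-- The number of configurations. -/
noncomputable def rigidZ (N : ℕ) : ℕ := Nat.card (RigidConfig N)

/-- The number of configurations, weighted by their number of contact links (a finite sum). -/
noncomputable def rigidY (N : ℕ) : ℕ := ∑ᶠ c : RigidConfig N, c.contacts

/-- The average number of contact links. -/
noncomputable def rigidK (N : ℕ) : ℝ := (rigidY N : ℝ) / (rigidZ N : ℝ)

/-! ### Cycle counts of permutations multiplied by transpositions and involutions -/

section OrbitCounting

open CombinatorialMap Equiv Equiv.Perm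

variable {D : Type*}

/-! Following the loop from the root labels every half-edge canonically by a pair `(i, j)`: the
`i`-th vertex and the `j`-th position around it. In these labels the rotation is fixed, the visited
edges form a standard loop, and the only freedom left is the involution `q` that pairs the unvisited
half-edges.

With n = 2N vertices and 2n edges, genus zero means n + 2 faces. The face permutation is `loopFace n
* q`. The loop alone contributes two cycles, its two sides, and `q` is a product of n disjoint
transpositions, each of which changes the number of cycles by one. So n + 2 is the largest possible
number, and it is reached exactly when every transposition splits a cycle. That happens exactly when
the unvisited edges are noncrossing arches on each side (`orbitCount_eq_iff_isArchSystem`).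
Noncrossing arches join positions of opposite parities, so the bicoloring imposes no further
condition.

Recording the left and right ends of the arches turns the two sides into two independent Dyck paths
of length 2N (`RigidConfig.words_bijective`), and the contact links on a side are the arches open at
the middle, counted by the mid-height (`RigidConfig.contacts_eq`). Write B(a) for the number of
nonnegative paths of length N from height a to 0, and C for the Catalan number. Then z = C² and y =
2C ∑ a B(a)², while ∑ B(a)² = C. Hence k = 2 ∑ (a + 1) B(a)² / C - 2, and the last sum is evaluated
because its partial sums have a closed form (`sum_range_ballot`).

The asymptotics follow from Stirling's formula for central binomial coefficients, treated separately
for even and odd N. -/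

theorem sameCycle_mem_of_forall_mem [Finite D] {p : Perm D} {S : Set D} (hS : ∀ x ∈ S, p x ∈ S)
    {a b : D} (h : p.SameCycle a b) (ha : a ∈ S) : b ∈ S := by
  obtain ⟨k, rfl⟩ := h.exists_nat_pow_eq
  clear h
  induction k with
  | zero => simpa using ha
  | succ k ih => rw [pow_succ', Perm.mul_apply]; exact hS _ ih

theorem sameCycle_of_forall_apply [Finite D] {p q : Perm D} (h : ∀ x, q.SameCycle x (p x))
    {a b : D} (hab : p.SameCycle a b) : q.SameCycle a b :=
  sameCycle_mem_of_forall_mem (S := {x | q.SameCycle a x})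
    (fun x hx => SameCycle.trans hx (h x)) hab (SameCycle.refl q a)

theorem sameCycle_permCongr_iff {E : Type*} (e : D ≃ E) (p : Perm D) (a b : D) :
    (e.permCongr p).SameCycle (e a) (e b) ↔ p.SameCycle a b := by
  have key : ∀ (k : ℤ) x, (e.permCongr p ^ k) (e x) = e ((p ^ k) x) := by
    intro k x
    have : e.permCongr p ^ k = e.permCongr (p ^ k) := (map_zpow e.permCongrHom p k).symm
    rw [this]; simp
  simp [SameCycle, key]

theorem orbitCount_permCongr {E : Type*} (e : D ≃ E) (p : Perm D) :
    orbitCount (e.permCongr p) = orbitCount p :=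
  Nat.card_congr (Quotient.congr e fun a b => (sameCycle_permCongr_iff e p a b).symm).symm

variable [DecidableEq D]

/-- The product sends `b` to `p a` and then follows the `p`-cycle of `a`, which never meets `b`,
until it arrives at `a`. The invariant set collects the points of that cycle already linked to `b`.
-/
theorem sameCycle_mul_swap_of_not_sameCycle [Finite D] {p : Perm D} {a b : D} (h : ¬ p.SameCycle a b) :
    (p * swap a b).SameCycle a b := by
  have hb : (p * swap a b) b = p a := by simp
  have hpa : (p * swap a b).SameCycle (p a) b := by
    rw [← hb]; exact (sameCycle_apply_left).2 (SameCycle.refl _ _)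
  refine (sameCycle_mem_of_forall_mem (p := p)
    (S := {z | p.SameCycle a z ∧ (p * swap a b).SameCycle z b}) ?_
    (a := p a) (b := a) (sameCycle_apply_left.2 (SameCycle.refl _ _))
    ⟨sameCycle_apply_right.2 (SameCycle.refl _ _), hpa⟩).2
  rintro z ⟨hz, hz'⟩
  refine ⟨sameCycle_apply_right.2 hz, ?_⟩
  by_cases hza : z = a
  · rw [hza]; exact hpa
  have hzb : z ≠ b := fun e => h (e ▸ hz)
  have : (p * swap a b) z = p z := by simp [swap_apply_of_ne_of_ne hza hzb]
  rw [← this]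
  exact sameCycle_apply_left.2 hz'

theorem sameCycle_mul_swap_of_sameCycle [Finite D] {p : Perm D} {a b : D} (h : ¬ p.SameCycle a b)
    {x y : D} (hxy : p.SameCycle x y) : (p * swap a b).SameCycle x y := by
  have hab := sameCycle_mul_swap_of_not_sameCycle h
  refine sameCycle_of_forall_apply (fun z => ?_) hxy
  by_cases hza : z = a
  · have : p z = (p * swap a b) b := by simp [hza]
    rw [this, hza]; exact sameCycle_apply_right.2 hab
  by_cases hzb : z = b
  · have : p z = (p * swap a b) a := by simp [hzb]
    rw [this, hzb]; exact sameCycle_apply_right.2 hab.symm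
  have : p z = (p * swap a b) z := by simp [swap_apply_of_ne_of_ne hza hzb]
  rw [this]
  exact sameCycle_apply_right.2 (SameCycle.refl _ _)

/-- Multiplying by a transposition of points of different cycles merges these cycles. -/
theorem orbitCount_mul_swap_add_one [Finite D] {p : Perm D} {a b : D} (h : ¬ p.SameCycle a b) :
    orbitCount (p * swap a b) + 1 = orbitCount p := by
  classical
  let Q := Quotient (SameCycle.setoid p)
  let mk : D → Q := Quotient.mk _
  have mk_eq : ∀ x y, mk x = mk y ↔ p.SameCycle x y := fun x y => Quotient.eq
  have mk_app : ∀ x, mk (p x) = mk x := fun x =>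
    (mk_eq _ _).2 (sameCycle_apply_left.2 (SameCycle.refl _ _))
  have hba : mk b ≠ mk a := fun e => h ((mk_eq _ _).1 e).symm
  -- Relabelling the class of `a` as that of `b` gives an invariant of the product. It identifies
  -- the cycles of the product with the classes of `p` other than that of `a`.
  let f : D → Q := fun x => if mk x = mk a then mk b else mk x
  have hf : ∀ x, f ((p * swap a b) x) = f x := by
    intro x
    by_cases hxa : x = a
    · simp [f, hxa, mk_app, hba]
    by_cases hxb : x = b
    · simp [f, hxb, mk_app]
    simp [f, swap_apply_of_ne_of_ne hxa hxb, mk_app]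
  have hsame : ∀ x y, (p * swap a b).SameCycle x y → f x = f y := fun x y hxy =>
    (sameCycle_mem_of_forall_mem (S := {z | f z = f x})
      (fun z hz => (hf z).trans hz) hxy rfl : f y = f x).symm
  have hne : ∀ x, f x ≠ mk a := by
    intro x
    by_cases hx : mk x = mk a <;> simp [f, hx, hba]
  have hrep : ∀ x, ∃ y, f x = mk y ∧ (p * swap a b).SameCycle x y := by
    intro x
    by_cases hx : mk x = mk a
    · refine ⟨b, by simp [f, hx], ?_⟩
      exact (sameCycle_mul_swap_of_sameCycle h ((mk_eq _ _).1 hx)).trans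
        (sameCycle_mul_swap_of_not_sameCycle h)
    · exact ⟨x, by simp [f, hx], SameCycle.refl _ _⟩
  let F : Quotient (SameCycle.setoid (p * swap a b)) → {q : Q // q ≠ mk a} :=
    Quotient.lift (fun x => ⟨f x, hne x⟩) fun x y hxy => Subtype.ext (hsame x y hxy)
  have hF : Function.Bijective F := by
    constructor
    · intro u v
      induction u using Quotient.inductionOn with | _ x
      induction v using Quotient.inductionOn with | _ y
      intro e
      have e' : f x = f y := congrArg Subtype.val e
      obtain ⟨x', hx, hx'⟩ := hrep x
      obtain ⟨y', hy, hy'⟩ := hrep y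
      rw [hx, hy, mk_eq] at e'
      exact Quotient.sound
        (hx'.trans ((sameCycle_mul_swap_of_sameCycle h e').trans hy'.symm))
    · rintro ⟨q, hq⟩
      induction q using Quotient.inductionOn with | _ x
      refine ⟨Quotient.mk _ x, Subtype.ext ?_⟩
      change f x = mk x
      have hq' : mk x ≠ mk a := hq
      simp [f, hq']
  have h1 : orbitCount (p * swap a b) = Nat.card {q : Q // q ≠ mk a} :=
    Nat.card_congr (Equiv.ofBijective F hF)
  rw [h1, ← Finite.card_option]
  exact Nat.card_congr (Equiv.optionSubtypeNe (mk a))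

/-- Let `k` be the first positive time at which `p` leads from `a` to `b`. From `b` the product
visits `p a`, `p² a`, …, `p^k a = b` and closes up, and `a` is not among these points. -/
theorem not_sameCycle_mul_swap [Finite D] {p : Perm D} {a b : D} (h : p.SameCycle a b) (hab : a ≠ b) :
    ¬ (p * swap a b).SameCycle a b := by
  classical
  have hex : ∃ k, 1 ≤ k ∧ (p ^ k) a = b := by
    obtain ⟨k, -, hk⟩ := h.exists_pow_eq'
    refine ⟨k, ?_, hk⟩
    rcases Nat.eq_zero_or_pos k with rfl | hk0
    · exact absurd (by simpa using hk) hab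
    · exact hk0
  obtain ⟨hk1, hkb⟩ := Nat.find_spec hex
  have hmin : ∀ j, j < Nat.find hex → ¬(1 ≤ j ∧ (p ^ j) a = b) := fun j hj => Nat.find_min hex hj
  set k := Nat.find hex
  have hna : ∀ j, 1 ≤ j → j ≤ k → (p ^ j) a ≠ a := by
    intro j hj1 hjk e
    have h2 : (p ^ (k - j)) a = b := by
      conv_lhs => rw [← e]
      rw [← Perm.mul_apply, ← pow_add, Nat.sub_add_cancel hjk, hkb]
    rcases Nat.eq_zero_or_pos (k - j) with h0 | h0
    · rw [h0] at h2; exact hab (by simpa using h2)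
    · exact hmin (k - j) (by omega) ⟨h0, h2⟩
  intro hc
  have := sameCycle_mem_of_forall_mem (S := {z | ∃ j, 1 ≤ j ∧ j ≤ k ∧ (p ^ j) a = z}) ?_ hc.symm
    ⟨k, hk1, le_rfl, hkb⟩
  · obtain ⟨j, h1, h2, h3⟩ := this
    exact hna j h1 h2 h3
  · rintro z ⟨j, h1, h2, rfl⟩
    rcases h2.lt_or_eq with h2 | h2
    · refine ⟨j + 1, by omega, h2, ?_⟩
      rw [Perm.mul_apply, swap_apply_of_ne_of_ne (hna j h1 h2.le) fun e => hmin j h2 ⟨h1, e⟩,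
        pow_succ', Perm.mul_apply]
    · refine ⟨1, le_rfl, hk1, ?_⟩
      rw [h2, hkb]; simp

/-- Multiplying by a transposition of two points of a cycle splits that cycle. -/
theorem orbitCount_mul_swap [Finite D] {p : Perm D} {a b : D} (h : p.SameCycle a b) (hab : a ≠ b) :
    orbitCount (p * swap a b) = orbitCount p + 1 := by
  have := orbitCount_mul_swap_add_one (not_sameCycle_mul_swap h hab)
  rw [mul_assoc, swap_mul_self, mul_one] at this
  exact this.symm

theorem orbitCount_mul_swap_le [Finite D] (p : Perm D) (a b : D) :
    orbitCount (p * swap a b) ≤ orbitCount p + 1 := by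
  by_cases hab : a = b
  · rw [hab, swap_self]
    exact Nat.le_succ _
  by_cases h : p.SameCycle a b
  · exact (orbitCount_mul_swap h hab).le
  · have := orbitCount_mul_swap_add_one h; omega

/-- Left multiplication by `swap x (q x)` deletes the pair `{x, q x}` from the involution: both
points become fixed and the others keep their partners. This is the induction step for every count
below. -/
theorem swap_mul_involutive {q : Perm D} (hq : Function.Involutive q) (x : D) :
    Function.Involutive (swap x (q x) * q) := by
  intro y
  by_cases h1 : y = x
  · simp [h1]
  by_cases h2 : y = q x
  · simp [h2, hq x]
  have h3 : q y ≠ x := fun e => h2 (by rw [← e, hq y])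
  have h4 : q y ≠ q x := fun e => h1 (q.injective e)
  simp [swap_apply_of_ne_of_ne h3 h4, hq y, swap_apply_of_ne_of_ne h1 h2]

theorem swap_mul_apply_of_ne {q : Perm D} (hq : Function.Involutive q) {x y : D} (h1 : y ≠ x)
    (h2 : y ≠ q x) : (swap x (q x) * q) y = q y := by
  have h3 : q y ≠ x := fun e => h2 (by rw [← e, hq y])
  have h4 : q y ≠ q x := fun e => h1 (q.injective e)
  simp [swap_apply_of_ne_of_ne h3 h4]

theorem swap_mul_apply_right {q : Perm D} (hq : Function.Involutive q) (x : D) :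
    (swap x (q x) * q) (q x) = q x := by simp [hq x]

theorem card_support_swap_mul_add_two [Fintype D] {q : Perm D} (hq : Function.Involutive q) {x : D}
    (hx : q x ≠ x) : (swap x (q x) * q).support.card + 2 = q.support.card := by
  have : (swap x (q x) * q).support = (q.support.erase x).erase (q x) := by
    ext y
    simp only [mem_support, Finset.mem_erase]
    by_cases h1 : y = x
    · simp [h1]
    by_cases h2 : y = q x
    · simp [h2, hq x]
    rw [swap_mul_apply_of_ne hq h1 h2]
    simp [h1, h2]
  have hx1 : x ∈ q.support := mem_support.2 hx
  have hx2 : q x ∈ q.support.erase x :=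
    Finset.mem_erase.2 ⟨hx, mem_support.2 fun e => hx (q.injective e)⟩
  rw [this, Finset.card_erase_of_mem hx2, Finset.card_erase_of_mem hx1]
  have := Finset.card_pos.2 ⟨_, hx2⟩
  rw [Finset.card_erase_of_mem hx1] at this
  omega

theorem mul_swap_mul_swap_mul (p q : Perm D) (x : D) :
    p * swap x (q x) * (swap x (q x) * q) = p * q := by
  rw [mul_assoc, ← mul_assoc (swap x (q x)), swap_mul_self, one_mul]

variable [Fintype D]

/-- An involution is a product of half as many transpositions as it has moved points, and each
creates at most one new cycle. Doubling avoids dividing the size of the support. -/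
theorem two_mul_orbitCount_mul_le (p : Perm D) {q : Perm D} (hq : Function.Involutive q) :
    2 * orbitCount (p * q) ≤ 2 * orbitCount p + q.support.card := by
  induction hn : q.support.card using Nat.strong_induction_on generalizing p q with
  | _ n ih =>
    by_cases h1 : q = 1
    · simp [h1]
    obtain ⟨x, hx⟩ : ∃ x, q x ≠ x := by
      by_contra! h
      exact h1 (Perm.ext h)
    have h2 := card_support_swap_mul_add_two hq hx
    have h3 := ih _ (by omega) (p * swap x (q x)) (swap_mul_involutive hq x) rfl
    rw [mul_swap_mul_swap_mul] at h3
    have h4 := orbitCount_mul_swap_le p x (q x)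
    omega

/-- If an involution `q` creates as many cycles as possible, each of its transpositions splits a
cycle of `p`, and the remaining transpositions still create as many cycles as possible. -/
theorem sameCycle_of_two_mul_orbitCount_mul_eq {p q : Perm D} (hq : Function.Involutive q)
    (h : 2 * orbitCount (p * q) = 2 * orbitCount p + q.support.card) {x : D} (hx : q x ≠ x) :
    p.SameCycle x (q x) ∧ 2 * orbitCount (p * swap x (q x) * (swap x (q x) * q)) =
      2 * orbitCount (p * swap x (q x)) + (swap x (q x) * q).support.card := by
  have h2 := card_support_swap_mul_add_two hq hx
  have h3 := two_mul_orbitCount_mul_le (p * swap x (q x)) (swap_mul_involutive hq x)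
  rw [mul_swap_mul_swap_mul] at h3 ⊢
  by_cases hs : p.SameCycle x (q x)
  · have h4 := orbitCount_mul_swap hs hx.symm
    exact ⟨hs, by omega⟩
  · have h4 := orbitCount_mul_swap_add_one hs
    omega

theorem orbitCount_mul_eq_card {D : Type*} [Fintype D] {p : Perm D} {k : ℕ}
    (h : ∀ d, {x | p.SameCycle d x}.ncard = k) : orbitCount p * k = Fintype.card D := by
  classical
  let mk : D → Quotient (SameCycle.setoid p) := Quotient.mk _
  have e : D ≃ Σ c : Quotient (SameCycle.setoid p), {x // mk x = c} :=
    (Equiv.sigmaFiberEquiv mk).symm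
  have hc : ∀ c : Quotient (SameCycle.setoid p), Nat.card {x // mk x = c} = k := by
    intro c
    induction c using Quotient.inductionOn with | _ d
    rw [← h d, ← Nat.card_coe_set_eq]
    refine Nat.card_congr (Equiv.subtypeEquivRight fun x => ?_)
    exact Quotient.eq.trans (sameCycle_comm)
  rw [← Nat.card_eq_fintype_card, Nat.card_congr e]
  have : Fintype (Quotient (SameCycle.setoid p)) := Fintype.ofFinite _
  rw [Nat.card_sigma, Finset.sum_congr rfl fun c _ => hc c]
  simp [orbitCount]

end OrbitCounting

/-! ### The standard loop: genus zero is equivalent to noncrossing arches -/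

section StandardModel

open CombinatorialMap Equiv Equiv.Perm

/-- Rotation around the vertices of the standard loop with `n` vertices: the vertex `i` has
half-edges `(i, 0)` (entry of the loop), `(i, 1)`, `(i, 2)` (exit of the loop) and `(i, 3)`. -/
def stdRot (n : ℕ) : Perm (Fin n × Fin 4) :=
  Equiv.prodCongr (Equiv.refl _) (Equiv.addRight 1)

@[simp] theorem stdRot_apply {n : ℕ} (i : Fin n) (j : Fin 4) : stdRot n (i, j) = (i, j + 1) := rfl

/-- The underlying function of `loopFlip`. -/
def loopFlipFun (n : ℕ) (x : Fin n × Fin 4) : Fin n × Fin 4 :=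
  if x.2 = 0 then ((finRotate n).symm x.1, 2) else if x.2 = 2 then (finRotate n x.1, 0) else x

theorem loopFlipFun_involutive (n : ℕ) : Function.Involutive (loopFlipFun n) := by
  rintro ⟨i, j⟩
  fin_cases j
  · exact Prod.ext ((finRotate n).apply_symm_apply i) rfl
  · rfl
  · exact Prod.ext ((finRotate n).symm_apply_apply i) rfl
  · rfl

/-- The exchange of the two half-edges of the edges of the standard loop; other half-edges are
fixed. -/
def loopFlip (n : ℕ) : Perm (Fin n × Fin 4) := (loopFlipFun_involutive n).toPerm

theorem loopFlip_involutive (n : ℕ) : Function.Involutive (loopFlip n) := loopFlipFun_involutive n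

theorem loopFlip_mul_self (n : ℕ) : loopFlip n * loopFlip n = 1 :=
  Perm.ext (loopFlip_involutive n)

@[simp] theorem loopFlip_zero {n : ℕ} (i : Fin n) :
    loopFlip n (i, 0) = ((finRotate n).symm i, 2) := rfl

@[simp] theorem loopFlip_one {n : ℕ} (i : Fin n) : loopFlip n (i, 1) = (i, 1) := rfl

@[simp] theorem loopFlip_two {n : ℕ} (i : Fin n) : loopFlip n (i, 2) = (finRotate n i, 0) := rfl

@[simp] theorem loopFlip_three {n : ℕ} (i : Fin n) : loopFlip n (i, 3) = (i, 3) := rfl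

/-- The face permutation of the loop. -/
def loopFace (n : ℕ) : Perm (Fin n × Fin 4) := stdRot n * loopFlip n

@[simp] theorem loopFace_zero {n : ℕ} (i : Fin n) :
    loopFace n (i, 0) = ((finRotate n).symm i, 3) := rfl

@[simp] theorem loopFace_one {n : ℕ} (i : Fin n) : loopFace n (i, 1) = (i, 2) := rfl

@[simp] theorem loopFace_two {n : ℕ} (i : Fin n) : loopFace n (i, 2) = (finRotate n i, 1) := rfl

@[simp] theorem loopFace_three {n : ℕ} (i : Fin n) : loopFace n (i, 3) = (i, 0) := by
  rw [loopFace, Perm.mul_apply, loopFlip_three, stdRot_apply]; rfl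

theorem finRotate_mk {n k : ℕ} (h : k + 1 < n) :
    finRotate n ⟨k, by omega⟩ = ⟨k + 1, h⟩ := by
  obtain ⟨n, rfl⟩ : ∃ m, n = m + 1 := ⟨n - 1, by omega⟩
  exact finRotate_of_lt (by omega)

theorem finRotate_symm_mk {n k : ℕ} (h : k + 1 < n) :
    (finRotate n).symm ⟨k + 1, h⟩ = ⟨k, by omega⟩ := by
  rw [Equiv.symm_apply_eq, finRotate_mk h]

theorem val_finRotate_eq_zero {n : ℕ} {i : Fin n} (hi : (i : ℕ) + 1 = n) :
    ((finRotate n i : Fin n) : ℕ) = 0 := by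
  obtain ⟨k, rfl⟩ : ∃ k, n = k + 1 := ⟨i, hi.symm⟩
  have : i = Fin.last k := Fin.ext (by simpa using hi)
  rw [this, finRotate_last]; rfl

/-- An involution of the half-edges of the standard loop pairing, on each side of the loop, the
unvisited half-edges by arches without crossings. Fixed points are allowed. -/
structure IsArchSystem {n : ℕ} (q : Perm (Fin n × Fin 4)) : Prop where
  involutive : Function.Involutive q
  snd_apply : ∀ x, (q x).2 = x.2
  apply_zero : ∀ i, q (i, 0) = (i, 0)
  apply_two : ∀ i, q (i, 2) = (i, 2)
  noncrossing : ∀ x y, x.2 = y.2 → x.1 < y.1 → y.1 < (q x).1 → ¬ (q x).1 < (q y).1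

namespace IsArchSystem

variable {n : ℕ} {q : Perm (Fin n × Fin 4)}

theorem odd_of_apply_ne (hq : IsArchSystem q) {x : Fin n × Fin 4} (hx : q x ≠ x) :
    x.2 = 1 ∨ x.2 = 3 := by
  obtain ⟨i, j⟩ := x
  fin_cases j
  · exact absurd (hq.apply_zero i) hx
  · exact Or.inl rfl
  · exact absurd (hq.apply_two i) hx
  · exact Or.inr rfl

theorem swap_mul_apply_eq_or (hq : IsArchSystem q) (x y : Fin n × Fin 4) :
    (swap x (q x) * q) y = y ∨ (swap x (q x) * q) y = q y := by
  by_cases h1 : y = x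
  · left; simp [h1]
  by_cases h2 : y = q x
  · left; simp [h2, hq.involutive x]
  · right; exact swap_mul_apply_of_ne hq.involutive h1 h2

theorem swap_mul (hq : IsArchSystem q) (x : Fin n × Fin 4) :
    IsArchSystem (swap x (q x) * q) where
  involutive := swap_mul_involutive hq.involutive x
  snd_apply y := by
    rcases hq.swap_mul_apply_eq_or x y with h | h <;> rw [h]
    exact hq.snd_apply y
  apply_zero i := by
    rcases hq.swap_mul_apply_eq_or x (i, 0) with h | h <;> rw [h]
    exact hq.apply_zero i
  apply_two i := by
    rcases hq.swap_mul_apply_eq_or x (i, 2) with h | h <;> rw [h]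
    exact hq.apply_two i
  noncrossing a b hab h1 h2 h3 := by
    rcases hq.swap_mul_apply_eq_or x a with h | h
    · rw [h] at h2; exact absurd h2 h1.asymm
    rcases hq.swap_mul_apply_eq_or x b with h' | h'
    · rw [h'] at h3; exact absurd h3 h2.asymm
    rw [h] at h2 h3
    rw [h'] at h3
    exact hq.noncrossing a b hab h1 h2 h3

/-- A shortest arch covers no end of another arch on its side, which makes it the one to remove in
an induction. -/
theorem exists_shortest (hq : IsArchSystem q) (h1 : q ≠ 1) :
    ∃ x, x.1 < (q x).1 ∧ ∀ y, y.1 < (q y).1 →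
      ((q x).1 : ℕ) - (x.1 : ℕ) ≤ ((q y).1 : ℕ) - (y.1 : ℕ) := by
  obtain ⟨z, hz⟩ : ∃ z, q z ≠ z := by
    by_contra! h
    exact h1 (Perm.ext h)
  have hne : (Finset.univ.filter fun x => x.1 < (q x).1).Nonempty := by
    rcases lt_trichotomy z.1 (q z).1 with h | h | h
    · exact ⟨z, by simpa using h⟩
    · exact absurd (Prod.ext h (hq.snd_apply z).symm).symm hz
    · exact ⟨q z, by simpa [hq.involutive z] using h⟩
  obtain ⟨x, hx, hmin⟩ := Finset.exists_min_image _
    (fun x : Fin n × Fin 4 => ((q x).1 : ℕ) - (x.1 : ℕ)) hne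
  exact ⟨x, by simpa using hx, fun y hy => hmin y (by simpa using hy)⟩

theorem swap_mul_apply_of_mem_Icc (hq : IsArchSystem q) {x : Fin n × Fin 4}
    (hmin : ∀ y, y.1 < (q y).1 → ((q x).1 : ℕ) - (x.1 : ℕ) ≤ ((q y).1 : ℕ) - (y.1 : ℕ))
    {y : Fin n × Fin 4} (h2 : y.2 = x.2) (hxy : x.1 ≤ y.1) (hyx : y.1 ≤ (q x).1) :
    (swap x (q x) * q) y = y := by
  rcases hxy.eq_or_lt with h | hxy
  · rw [show y = x from Prod.ext h.symm h2]; simp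
  rcases hyx.eq_or_lt with h | hyx
  · rw [show y = q x from Prod.ext h (h2.trans (hq.snd_apply x).symm)]
    exact swap_mul_apply_right hq.involutive x
  rw [swap_mul_apply_of_ne hq.involutive (fun e => hxy.ne' (by rw [e]))
    (fun e => hyx.ne (by rw [e]))]
  -- An arch with one end strictly under the arch of `x` cannot leave to the right (`c1`) or to the
  -- left (`c2`) without crossing. Staying inside, it would be shorter than the shortest arch, so
  -- `y` must be fixed.
  have c1 := hq.noncrossing x y h2.symm hxy hyx
  have c2 := hq.noncrossing (q y) x ((hq.snd_apply y).trans h2)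
  rw [hq.involutive y] at c2
  have c3 : (q y).1 ≠ x.1 := fun e => by
    have e2 : q y = x := Prod.ext e ((hq.snd_apply y).trans h2)
    have : y = q x := by rw [← e2, hq.involutive y]
    exact hyx.ne (by rw [this])
  have c4 : (q y).1 ≠ (q x).1 := fun e => by
    have : q y = q x := Prod.ext e (by rw [hq.snd_apply, hq.snd_apply, h2])
    exact hxy.ne' (by rw [q.injective this])
  have m1 := hmin y
  have m2 := hmin (q y)
  rw [hq.involutive y] at m2
  refine Prod.ext (Fin.ext ?_) (hq.snd_apply y)
  simp only [Fin.lt_def, ne_eq, Fin.ext_iff] at *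
  by_contra h
  rcases Nat.lt_or_gt_of_ne h with h' | h'
  · have := m2 h'
    by_cases h5 : ((q y).1 : ℕ) < x.1
    · exact c2 h5 hxy hyx
    · omega
  · have := m1 h'
    omega

/-- Where `q` is the identity, the face permutation simply walks along the side of the loop, taking
two steps per vertex. -/
theorem sameCycle_of_forall_fixed (hq : IsArchSystem q) {j : Fin 4} (hj : j = 1 ∨ j = 3)
    {a b : Fin n} (hab : a ≤ b) (h : ∀ k, a ≤ k → k ≤ b → q (k, j) = (k, j)) :
    (loopFace n * q).SameCycle (a, j) (b, j) := by
  have hstep : ∀ (k : ℕ) (hk : k + 1 < n), q (⟨k, by omega⟩, j) = (⟨k, by omega⟩, j) →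
      q (⟨k + 1, hk⟩, j) = (⟨k + 1, hk⟩, j) →
      (loopFace n * q).SameCycle (⟨k, by omega⟩, j) (⟨k + 1, hk⟩, j) := by
    intro k hk h1 h2
    -- Side `1` is followed in the direction of the loop and side `3` against it, hence the `symm`
    -- in the second case.
    rcases hj with rfl | rfl
    · refine ⟨2, ?_⟩
      rw [zpow_two]
      simp [h1, hq.apply_two, finRotate_mk hk]
    · refine SameCycle.symm ⟨2, ?_⟩
      rw [zpow_two]
      simp [h2, hq.apply_zero, finRotate_symm_mk hk]
  obtain ⟨b, hb⟩ := b
  induction b with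
  | zero =>
    have : a = ⟨0, hb⟩ := Fin.ext (by simpa [Fin.le_def] using hab)
    rw [this]
  | succ b ih =>
    rcases hab.eq_or_lt with e | hlt
    · rw [e]
    have hlt' : (a : ℕ) < b + 1 := hlt
    have hab' : a ≤ ⟨b, by omega⟩ := Fin.le_def.2 (by simp; omega)
    refine (ih (by omega) hab' (fun k h1 h2 => h k h1 (h2.trans ?_)) hstep).trans
      (hstep b hb (h _ hab' ?_) (h _ hab le_rfl)) <;> simp [Fin.le_def]

/-- Remove a shortest arch. Nothing else is attached between its ends, so they lie in one cycle of
what remains, and putting the arch back splits that cycle. -/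
theorem two_mul_orbitCount (hq : IsArchSystem q) :
    2 * orbitCount (loopFace n * q) = 2 * orbitCount (loopFace n) + q.support.card := by
  induction hn : q.support.card using Nat.strong_induction_on generalizing q with
  | _ m ih =>
    by_cases h1 : q = 1
    · rw [← hn]; simp [h1]
    obtain ⟨x, hx, hmin⟩ := hq.exists_shortest h1
    have hne : q x ≠ x := fun e => hx.ne (by rw [e])
    have h2 := card_support_swap_mul_add_two hq.involutive hne
    have h3 := ih _ (by omega) (hq.swap_mul x) rfl
    -- The transposition commutes with `q`, since conjugation by `q` only exchanges its two points.
    have h4 : loopFace n * q = loopFace n * (swap x (q x) * q) * swap x (q x) := by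
      rw [mul_assoc, mul_assoc, Equiv.mul_swap_eq_swap_mul, hq.involutive x, swap_comm (q x) x,
        ← mul_assoc (swap x (q x)), swap_mul_self, one_mul]
    have hs : (loopFace n * (swap x (q x) * q)).SameCycle x (q x) := by
      have := (hq.swap_mul x).sameCycle_of_forall_fixed (hq.odd_of_apply_ne hne) hx.le
        fun k h5 h6 => hq.swap_mul_apply_of_mem_Icc hmin rfl h5 h6
      rwa [show ((q x).1, x.2) = q x from Prod.ext rfl (hq.snd_apply x).symm] at this
    rw [h4, orbitCount_mul_swap hs hne.symm]
    omega

end IsArchSystem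

/-- Half-edges on the side of the loop containing the half-edges `(i, 1)`. -/
def leftSide (n : ℕ) : Set (Fin n × Fin 4) := {x | x.2 = 1 ∨ x.2 = 2}

theorem loopFace_mem_leftSide {n : ℕ} (x : Fin n × Fin 4) :
    loopFace n x ∈ leftSide n ↔ x ∈ leftSide n := by
  obtain ⟨i, j⟩ := x
  fin_cases j <;> simp [leftSide]

theorem mem_leftSide_iff_of_sameCycle {n : ℕ} {x y : Fin n × Fin 4}
    (h : (loopFace n).SameCycle x y) : x ∈ leftSide n ↔ y ∈ leftSide n :=
  ⟨fun hx => sameCycle_mem_of_forall_mem (fun z hz => (loopFace_mem_leftSide z).2 hz) h hx,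
   fun hy => sameCycle_mem_of_forall_mem (fun z hz => (loopFace_mem_leftSide z).2 hz) h.symm hy⟩

theorem isArchSystem_one (n : ℕ) : IsArchSystem (1 : Perm (Fin n × Fin 4)) where
  involutive _ := rfl
  snd_apply _ := rfl
  apply_zero _ := rfl
  apply_two _ := rfl
  noncrossing _ _ _ h1 h2 := absurd h2 h1.asymm

/-- One cycle runs forward through the half-edges `(i, 1)`, `(i, 2)`, the other backward through
`(i, 3)`, `(i, 0)`: the two sides of the loop. -/
theorem orbitCount_loopFace {n : ℕ} (hn : 0 < n) : orbitCount (loopFace n) = 2 := by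
  have key : ∀ (j : Fin 4), j = 1 ∨ j = 3 → ∀ i : Fin n,
      (loopFace n).SameCycle (⟨0, hn⟩, j) (i, j) := by
    intro j hj i
    have := (isArchSystem_one n).sameCycle_of_forall_fixed hj (a := ⟨0, hn⟩) (b := i)
      (Fin.le_def.2 (Nat.zero_le _)) fun _ _ _ => rfl
    rwa [mul_one] at this
  have h1 : ∀ x ∈ leftSide n, (loopFace n).SameCycle (⟨0, hn⟩, 1) x := by
    rintro ⟨i, j⟩ (h | h) <;> obtain rfl : j = _ := h
    · exact key 1 (Or.inl rfl) i
    · exact (key 1 (Or.inl rfl) i).trans ⟨1, by simp⟩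
  have h3 : ∀ x ∉ leftSide n, (loopFace n).SameCycle (⟨0, hn⟩, 3) x := by
    rintro ⟨i, j⟩ h
    fin_cases j
    · exact (key 3 (Or.inr rfl) i).trans ⟨1, by simp⟩
    · simp [leftSide] at h
    · simp [leftSide] at h
    · exact key 3 (Or.inr rfl) i
  classical
  let F : Quotient (SameCycle.setoid (loopFace n)) → Bool :=
    Quotient.lift (fun x => decide (x ∈ leftSide n)) fun x y hxy => by
      simp only [mem_leftSide_iff_of_sameCycle hxy]
  have hF : Function.Bijective F := by
    constructor
    · intro u v
      induction u using Quotient.inductionOn with | _ x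
      induction v using Quotient.inductionOn with | _ y
      intro e
      have e' : x ∈ leftSide n ↔ y ∈ leftSide n := by simpa [F] using e
      refine Quotient.sound ?_
      by_cases hx : x ∈ leftSide n
      · exact (h1 x hx).symm.trans (h1 y (e'.1 hx))
      · exact (h3 x hx).symm.trans (h3 y (mt e'.2 hx))
    · rintro (_ | _)
      · exact ⟨Quotient.mk _ (⟨0, hn⟩, 3), by
          change decide ((⟨0, hn⟩, 3) ∈ leftSide n) = false
          simp [leftSide]⟩
      · exact ⟨Quotient.mk _ (⟨0, hn⟩, 1), by
          change decide ((⟨0, hn⟩, 1) ∈ leftSide n) = true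
          simp [leftSide]⟩
  rw [orbitCount, Nat.card_congr (Equiv.ofBijective F hF)]
  simp

/-- Genus zero forces the unvisited edges to form arch systems on both sides of the loop. -/
theorem isArchSystem_of_two_mul_orbitCount {n : ℕ} {q : Perm (Fin n × Fin 4)}
    (hq : Function.Involutive q) (h0 : ∀ i, q (i, 0) = (i, 0)) (h2 : ∀ i, q (i, 2) = (i, 2))
    (h : 2 * orbitCount (loopFace n * q) = 2 * orbitCount (loopFace n) + q.support.card) :
    IsArchSystem q := by
  have hfix : ∀ x : Fin n × Fin 4, x.2 = 0 ∨ x.2 = 2 → q x = x := by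
    rintro ⟨i, j⟩ (h | h) <;> obtain rfl : j = _ := h
    · exact h0 i
    · exact h2 i
  -- Each transposition must split a cycle of `loopFace`, so both of its ends are on the same side
  -- of the loop; on each side only one position is unvisited.
  have hsnd : ∀ x, (q x).2 = x.2 := by
    intro x
    by_cases hx : q x = x
    · rw [hx]
    have hs := (sameCycle_of_two_mul_orbitCount_mul_eq hq h hx).1
    have hl := mem_leftSide_iff_of_sameCycle hs
    have hodd : ¬ (x.2 = 0 ∨ x.2 = 2) := fun e => hx (hfix x e)
    have hodd' : ¬ ((q x).2 = 0 ∨ (q x).2 = 2) := fun e => hx (q.injective (hfix _ e))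
    simp only [leftSide, Set.mem_ofPred_eq] at hl
    revert hl hodd hodd'
    generalize (q x).2 = a
    generalize x.2 = b
    revert a b
    decide
  refine ⟨hq, hsnd, h0, h2, ?_⟩
  intro x y hxy l1 l2 l3
  have hx : q x ≠ x := fun e => (l1.trans l2).ne (by rw [e])
  have hy : q y ≠ y := fun e => (l2.trans l3).ne (by rw [e])
  -- After the arch of `x` has split its cycle, extremality persists, so the arch of `y` must still
  -- split a cycle. A crossing is refuted by showing that its two ends have been separated.
  obtain ⟨-, ht⟩ := sameCycle_of_two_mul_orbitCount_mul_eq hq h hx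
  have hyx : y ≠ x := fun e => l1.ne' (by rw [e])
  have hyqx : y ≠ q x := fun e => l2.ne (by rw [e])
  have hy' : (swap x (q x) * q) y = q y := swap_mul_apply_of_ne hq hyx hyqx
  obtain ⟨hs, -⟩ := sameCycle_of_two_mul_orbitCount_mul_eq (swap_mul_involutive hq x) ht
    (x := y) (by rw [hy']; exact hy)
  rw [hy'] at hs
  have hodd : ¬ (x.2 = 0 ∨ x.2 = 2) := fun e => hx (hfix x e)
  obtain ⟨a, j⟩ := x
  obtain ⟨b, hb⟩ : ∃ b, q (a, j) = (b, j) := ⟨_, Prod.ext rfl (hsnd _)⟩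
  obtain ⟨c, j'⟩ := y
  obtain rfl : j = j' := hxy
  obtain ⟨d, hd⟩ : ∃ d, q (c, j) = (d, j) := ⟨_, Prod.ext rfl (hsnd _)⟩
  simp only [hb, hd] at l1 l2 l3 hs hodd
  have hj : j = 1 ∨ j = 3 :=
    (by decide : ∀ j : Fin 4, ¬ (j = 0 ∨ j = 2) → j = 1 ∨ j = 3) j hodd
  have hsucc : ∀ k l : Fin n, k < l → ((finRotate n k : Fin n) : ℕ) = k + 1 := by
    intro k l hkl
    rw [show k = ⟨k, k.2⟩ from rfl, finRotate_mk (lt_of_le_of_lt (Nat.succ_le_of_lt hkl) l.2)]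
  have hpred : ∀ k l : Fin n, l < k → (((finRotate n).symm k : Fin n) : ℕ) + 1 = k := by
    intro k l hkl
    obtain ⟨k, hk⟩ := k
    obtain ⟨k, rfl⟩ : ∃ m, k = m + 1 := ⟨k - 1, by have : (l : ℕ) < k := hkl; omega⟩
    rw [finRotate_symm_mk hk]
  -- The invariant sets describe the cycle cut off by the arch from `a` to `b`. On side `1` it jumps
  -- from `b` to the exit `(a, 2)`, so `(a, 1)` is excluded. On side `3` the walk is reversed and
  -- jumps from `a` to the entry `(b, 0)`, so `(b, 3)` is excluded.
  rcases hj with rfl | rfl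
  · have := sameCycle_mem_of_forall_mem
      (S := {z | (z.2 = 1 ∧ a < z.1 ∧ z.1 ≤ b) ∨ (z.2 = 2 ∧ a ≤ z.1 ∧ z.1 < b)}) ?_ hs
      (Or.inl ⟨rfl, l1, l2.le⟩)
    · rcases this with ⟨-, -, h⟩ | ⟨h, -⟩
      · exact absurd l3 h.not_gt
      · simp at h
    · rintro ⟨k, j⟩ (⟨h, hk1, hk2⟩ | ⟨h, hk1, hk2⟩) <;> obtain rfl : j = _ := h
      · have hka : k ≠ a := hk1.ne'
        by_cases hkb : k = b
        · right; subst hkb; simp [l1.trans l2]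
        · right
          rw [Perm.mul_apply, swap_apply_of_ne_of_ne (by simp [hka]) (by simp [hkb])]
          exact ⟨rfl, hk1.le, lt_of_le_of_ne hk2 hkb⟩
      · left
        rw [Perm.mul_apply, swap_apply_of_ne_of_ne (by simp) (by simp)]
        have := hsucc k b hk2
        refine ⟨rfl, ?_, ?_⟩
        · rw [loopFace_two, Fin.lt_def, this]; exact Nat.lt_succ_of_le hk1
        · rw [loopFace_two, Fin.le_def, this]; exact hk2
  · have := sameCycle_mem_of_forall_mem
      (S := {z | (z.2 = 3 ∧ a ≤ z.1 ∧ z.1 < b) ∨ (z.2 = 0 ∧ a < z.1 ∧ z.1 ≤ b)}) ?_ hs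
      (Or.inl ⟨rfl, l1.le, l2⟩)
    · rcases this with ⟨-, -, h⟩ | ⟨h, -⟩
      · exact absurd l3 h.asymm
      · simp at h
    · rintro ⟨k, j⟩ (⟨h, hk1, hk2⟩ | ⟨h, hk1, hk2⟩) <;> obtain rfl : j = _ := h
      · have hkb : k ≠ b := hk2.ne
        by_cases hka : k = a
        · right; subst hka; simp [l1.trans l2]
        · right
          rw [Perm.mul_apply, swap_apply_of_ne_of_ne (by simp [hka]) (by simp [hkb])]
          exact ⟨rfl, lt_of_le_of_ne hk1 (Ne.symm hka), hk2.le⟩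
      · left
        rw [Perm.mul_apply, swap_apply_of_ne_of_ne (by simp) (by simp)]
        change a < k at hk1
        change k ≤ b at hk2
        have := hpred k a hk1
        rw [Fin.lt_def] at hk1
        rw [Fin.le_def] at hk2
        refine ⟨rfl, ?_, ?_⟩
        · change (a : ℕ) ≤ ((finRotate n).symm k : Fin n); omega
        · change (((finRotate n).symm k : Fin n) : ℕ) < b; omega

/-- An involution without fixed points on the unvisited half-edges of the loop gives a genus zero
surface if and only if it is a pair of arch systems. -/
theorem orbitCount_eq_iff_isArchSystem {n : ℕ} (hn : 0 < n) {q : Perm (Fin n × Fin 4)}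
    (hq : Function.Involutive q) (h0 : ∀ i, q (i, 0) = (i, 0)) (h2 : ∀ i, q (i, 2) = (i, 2))
    (h1 : ∀ i, q (i, 1) ≠ (i, 1)) (h3 : ∀ i, q (i, 3) ≠ (i, 3)) :
    orbitCount (loopFace n * q) = n + 2 ↔ IsArchSystem q := by
  have hs : q.support = Finset.univ ×ˢ {1, 3} := by
    ext ⟨i, j⟩
    fin_cases j <;> simp [h0, h1, h2, h3]
  have hc : q.support.card = 2 * n := by
    rw [hs, Finset.card_product]
    simp [mul_comm]
  have hl := orbitCount_loopFace hn
  constructor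
  · intro h
    exact isArchSystem_of_two_mul_orbitCount hq h0 h2 (by omega)
  · intro h
    have := h.two_mul_orbitCount
    omega

end StandardModel

/-! ### Noncrossing matchings and Dyck paths -/

section DyckWords

/-- The `i`-th step of a path, `0` outside the path. -/
def pathStep {m : ℕ} (w : Fin m → Bool) (i : ℕ) : ℤ :=
  if h : i < m then (if w ⟨i, h⟩ then 1 else -1) else 0

/-- The height of a path with steps `±1` after `k` steps. -/
def pathHeight {m : ℕ} (w : Fin m → Bool) (k : ℕ) : ℤ := ∑ i ∈ Finset.range k, pathStep w i

@[simp] theorem pathHeight_zero {m : ℕ} (w : Fin m → Bool) : pathHeight w 0 = 0 := rfl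

theorem pathHeight_succ {m : ℕ} (w : Fin m → Bool) (k : ℕ) :
    pathHeight w (k + 1) = pathHeight w k + pathStep w k := Finset.sum_range_succ _ _

theorem pathStep_of_true {m : ℕ} {w : Fin m → Bool} {i : Fin m} (h : w i = true) :
    pathStep w i = 1 := by simp [pathStep, h]

theorem pathStep_of_false {m : ℕ} {w : Fin m → Bool} {i : Fin m} (h : w i = false) :
    pathStep w i = -1 := by simp [pathStep, h]

/-- Dyck paths: nonnegative paths from height `0` to height `0`. -/
def IsDyckPath {m : ℕ} (w : Fin m → Bool) : Prop :=
  (∀ k ≤ m, 0 ≤ pathHeight w k) ∧ pathHeight w m = 0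

/-- Noncrossing perfect matchings of `m` points on a line. -/
structure IsArchMatching {m : ℕ} (a : Fin m → Fin m) : Prop where
  involutive : Function.Involutive a
  apply_ne : ∀ i, a i ≠ i
  noncrossing : ∀ i j, i < j → j < a i → ¬ a i < a j

/-- The word of a matching records which points are the left ends of their arches. -/
def archWord {m : ℕ} (a : Fin m → Fin m) (i : Fin m) : Bool := decide (i < a i)

namespace IsArchMatching

variable {m : ℕ} {a b : Fin m → Fin m}

/-- The height is the number of arches open just before position `k`. Passing a left end inserts it
in the set of open arches, and passing a right end erases its partner. -/
theorem pathHeight_archWord (ha : IsArchMatching a) {k : ℕ} (hk : k ≤ m) :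
    pathHeight (archWord a) k =
      (Finset.univ.filter fun i : Fin m => (i : ℕ) < k ∧ k ≤ (a i : ℕ)).card := by
  induction k with
  | zero => simp
  | succ k ih =>
    rw [pathHeight_succ, ih (by omega)]
    set K : Fin m := ⟨k, hk⟩ with hK
    have hinv : ∀ i, (a i : ℕ) = k → i = a K := fun i hi => by
      rw [← ha.involutive i]; exact congrArg a (Fin.ext hi)
    have hne : (a K : ℕ) ≠ k := fun e => ha.apply_ne K (Fin.ext e)
    by_cases h : K < a K
    · have hs : pathStep (archWord a) k = 1 := pathStep_of_true (i := K) (by simp [archWord, h])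
      have h' : k < (a K : ℕ) := h
      have : (Finset.univ.filter fun i : Fin m => (i : ℕ) < k + 1 ∧ k + 1 ≤ (a i : ℕ)) =
          insert K (Finset.univ.filter fun i : Fin m => (i : ℕ) < k ∧ k ≤ (a i : ℕ)) := by
        ext i
        simp only [Finset.mem_filter, Finset.mem_univ, true_and, Finset.mem_insert]
        constructor
        · rintro ⟨h1, h2⟩
          rcases Nat.lt_succ_iff_lt_or_eq.1 h1 with h1 | h1
          · exact Or.inr ⟨h1, by omega⟩
          · exact Or.inl (Fin.ext h1)
        · rintro (rfl | ⟨h1, h2⟩)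
          · exact ⟨Nat.lt_succ_self k, h'⟩
          · refine ⟨by omega, ?_⟩
            rcases h2.eq_or_lt with e | e
            · have := hinv i e.symm
              rw [this] at h1; omega
            · exact e
      rw [this, Finset.card_insert_of_notMem (by simp [hK]), hs]
      push_cast; ring
    · have hs : pathStep (archWord a) k = -1 := pathStep_of_false (i := K) (by simpa [archWord] using h)
      have h' : (a K : ℕ) < k := lt_of_le_of_ne (not_lt.1 h) hne
      have hmem : a K ∈ Finset.univ.filter fun i : Fin m => (i : ℕ) < k ∧ k ≤ (a i : ℕ) := by
        refine Finset.mem_filter.2 ⟨Finset.mem_univ _, h', ?_⟩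
        rw [ha.involutive K]
      have : (Finset.univ.filter fun i : Fin m => (i : ℕ) < k + 1 ∧ k + 1 ≤ (a i : ℕ)) =
          (Finset.univ.filter fun i : Fin m => (i : ℕ) < k ∧ k ≤ (a i : ℕ)).erase (a K) := by
        ext i
        simp only [Finset.mem_filter, Finset.mem_univ, true_and, Finset.mem_erase]
        constructor
        · rintro ⟨h1, h2⟩
          refine ⟨fun e => ?_, ?_, by omega⟩
          · rw [e, ha.involutive K] at h2; simp [hK] at h2
          · rcases Nat.lt_succ_iff_lt_or_eq.1 h1 with h1 | h1
            · exact h1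
            · have : i = K := Fin.ext h1
              rw [this] at h2; omega
        · rintro ⟨h0, h1, h2⟩
          refine ⟨by omega, ?_⟩
          rcases h2.eq_or_lt with e | e
          · exact absurd (hinv i e.symm) h0
          · exact e
      rw [this, hs, Finset.card_erase_of_mem hmem]
      have := Finset.card_pos.2 ⟨_, hmem⟩
      push_cast [Nat.cast_sub (show 1 ≤ _ from this)]
      ring

theorem isDyckPath (ha : IsArchMatching a) : IsDyckPath (archWord a) := by
  refine ⟨fun k hk => ?_, ?_⟩
  · rw [ha.pathHeight_archWord hk]; positivity
  · rw [ha.pathHeight_archWord le_rfl, Nat.cast_eq_zero, Finset.card_eq_zero,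
      Finset.filter_eq_empty_iff]
    intro i _ h
    exact absurd h.2 (not_le.2 (a i).2)

theorem lt_of_archWord (ha : IsArchMatching a) {i : Fin m} (h : archWord a i = false) :
    a i < i :=
  lt_of_le_of_ne (not_lt.1 (by simpa [archWord] using h)) (ha.apply_ne i)

/-- Suppose `a j < b j < j`. As `b j` is a left end for `b`, it is one for `a` too. If its
`a`-partner is before `j`, the two matchings agree there and force that partner to be `j`; if after
`j`, its arch crosses the arch from `a j` to `j`. -/
theorem not_lt_of_agree (ha : IsArchMatching a) (hb : IsArchMatching b)
    (h : archWord a = archWord b) {j : Fin m} (hj : archWord a j = false)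
    (ih : ∀ i < j, archWord a i = false → a i = b i) : ¬ a j < b j := by
  intro hlt
  have hbj : b j < j := hb.lt_of_archWord (h ▸ hj)
  have h1 : archWord b (b j) = true := by simp [archWord, hb.involutive j, hbj]
  rw [← h] at h1
  have h2 : b j < a (b j) := by simpa [archWord] using h1
  have h3 : a (b j) ≠ j := fun e => by
    have := congrArg a e
    rw [ha.involutive] at this
    exact hlt.ne' this
  rcases lt_or_gt_of_ne h3 with h4 | h4
  · have h5 : archWord a (a (b j)) = false := by
      simp only [archWord, ha.involutive (b j), decide_eq_false_iff_not]
      exact h2.asymm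
    have h6 := ih _ h4 h5
    rw [ha.involutive] at h6
    exact h3 (hb.involutive.injective h6.symm)
  · refine ha.noncrossing (a j) (b j) hlt ?_ ?_
    · rw [ha.involutive j]; exact hbj
    · rw [ha.involutive j]; exact h4

/-- A noncrossing matching is determined by its word. -/
theorem eq_of_archWord_eq (ha : IsArchMatching a) (hb : IsArchMatching b)
    (h : archWord a = archWord b) : a = b := by
  have key : ∀ j, archWord a j = false → a j = b j := by
    intro j
    induction j using WellFoundedLT.induction with
    | _ j ih =>
      intro hj
      have c1 := ha.not_lt_of_agree hb h hj ih
      have c2 := hb.not_lt_of_agree ha h.symm (h ▸ hj)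
        fun i hi hi' => (ih i hi (by rw [h]; exact hi')).symm
      exact le_antisymm (not_lt.1 c2) (not_lt.1 c1)
  funext j
  cases hj : archWord a j with
  | false => exact key j hj
  | true =>
    have h2 : j < a j := by simpa [archWord] using hj
    have h5 : archWord a (a j) = false := by
      simp only [archWord, ha.involutive j, decide_eq_false_iff_not]
      exact h2.asymm
    have h6 := key _ h5
    rw [ha.involutive] at h6
    have h7 := congrArg b h6
    rw [hb.involutive] at h7
    exact h7.symm

end IsArchMatching

/-- The positions `i < j` are the two ends of an arch in the matching of the Dyck path `w`. -/
def IsArch {m : ℕ} (w : Fin m → Bool) (i j : ℕ) : Prop :=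
  i < j ∧ pathHeight w i = pathHeight w (j + 1) ∧
    ∀ k, i < k → k ≤ j → pathHeight w i < pathHeight w k

theorem pathStep_le {m : ℕ} (w : Fin m → Bool) (i : ℕ) : pathStep w i ≤ 1 := by
  unfold pathStep; split_ifs <;> simp

theorem neg_one_le_pathStep {m : ℕ} (w : Fin m → Bool) (i : ℕ) : -1 ≤ pathStep w i := by
  unfold pathStep; split_ifs <;> simp

namespace IsDyckPath

variable {m : ℕ} {w : Fin m → Bool}

theorem exists_isArch_right (hw : IsDyckPath w) {i : Fin m} (hi : w i = true) :
    ∃ j : Fin m, IsArch w i j := by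
  classical
  have hstep := pathHeight_succ w i
  rw [pathStep_of_true hi] at hstep
  -- The right end of the arch is the step just before the first time the path is back at its height
  -- before step `i`, hence the shift `K = j + 1`.
  have hex : ∃ k, (i : ℕ) < k ∧ pathHeight w k ≤ pathHeight w i :=
    ⟨m, i.2, by rw [hw.2]; exact hw.1 _ i.2.le⟩
  obtain ⟨h1, h2⟩ := Nat.find_spec hex
  have hmin : ∀ k < Nat.find hex, ¬((i : ℕ) < k ∧ pathHeight w k ≤ pathHeight w i) :=
    fun k hk => Nat.find_min hex hk
  have hle : Nat.find hex ≤ m := Nat.find_le ⟨i.2, by rw [hw.2]; exact hw.1 _ i.2.le⟩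
  set K := Nat.find hex
  obtain ⟨j, hj⟩ : ∃ j, K = j + 1 := ⟨K - 1, by omega⟩
  rw [hj] at h1 h2 hle hmin
  have hij : (i : ℕ) < j := by
    refine lt_of_le_of_ne (Nat.lt_succ_iff.1 h1) fun e => ?_
    rw [← e, hstep] at h2
    omega
  have hall : ∀ k, (i : ℕ) < k → k ≤ j → pathHeight w i < pathHeight w k := fun k h3 h4 =>
    not_le.1 fun h5 => hmin k (by omega) ⟨h3, h5⟩
  refine ⟨⟨j, hle⟩, hij, ?_, hall⟩
  have h6 := hall j hij le_rfl
  have h7 := pathHeight_succ w j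
  have h8 := neg_one_le_pathStep w j
  change pathHeight w i = pathHeight w (j + 1)
  omega

theorem exists_isArch_left (hw : IsDyckPath w) {j : Fin m} (hj : w j = false) :
    ∃ i : Fin m, IsArch w i j := by
  classical
  have hstep := pathHeight_succ w j
  rw [pathStep_of_false hj] at hstep
  have h0 : pathHeight w 0 ≤ pathHeight w (j + 1) := hw.1 _ j.2
  -- Symmetrically, the left end is the last time up to `j` at which the path is no higher than
  -- after step `j`.
  set P : ℕ → Prop := fun k => pathHeight w k ≤ pathHeight w (j + 1) with hP
  have h1 : P (Nat.findGreatest P j) := Nat.findGreatest_spec (P := P) (Nat.zero_le _) h0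
  have hle : Nat.findGreatest P j ≤ j := Nat.findGreatest_le _
  have hall : ∀ k, Nat.findGreatest P j < k → k ≤ j → ¬ P k :=
    fun k h2 h3 => Nat.findGreatest_is_greatest h2 h3
  set i := Nat.findGreatest P j
  simp only [hP, not_le] at h1 hall
  have hij : i < j := by
    refine lt_of_le_of_ne hle fun e => ?_
    rw [e] at h1
    omega
  have h6 := hall (i + 1) (by omega) hij
  have h7 := pathHeight_succ w i
  have h8 := pathStep_le w i
  have he : pathHeight w i = pathHeight w (j + 1) := by omega
  refine ⟨⟨i, hij.trans j.2⟩, hij, he, fun k h2 h3 => ?_⟩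
  change pathHeight w i < _
  rw [he]
  exact hall k h2 h3

end IsDyckPath

namespace IsArch

variable {m : ℕ} {w : Fin m → Bool}

theorem left_eq_true {i : Fin m} {j : ℕ} (h : IsArch w i j) : w i = true := by
  have h1 := h.2.2 (i + 1) (Nat.lt_succ_self _) h.1
  rw [pathHeight_succ] at h1
  cases hi : w i with
  | true => rfl
  | false => rw [pathStep_of_false hi] at h1; omega

theorem right_eq_false {i : ℕ} {j : Fin m} (h : IsArch w i j) : w j = false := by
  have h1 := h.2.2 j h.1 le_rfl
  rw [h.2.1, pathHeight_succ] at h1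
  cases hi : w j with
  | false => rfl
  | true => rw [pathStep_of_true hi] at h1; omega

theorem right_unique {i j j' : ℕ} (h : IsArch w i j) (h' : IsArch w i j') : j = j' := by
  by_contra hne
  rcases Nat.lt_or_gt_of_ne hne with hlt | hlt
  · have := h'.2.2 (j + 1) (by have := h.1; omega) hlt
    have := h.2.1
    omega
  · have := h.2.2 (j' + 1) (by have := h'.1; omega) hlt
    have := h'.2.1
    omega

theorem left_unique {i i' j : ℕ} (h : IsArch w i j) (h' : IsArch w i' j) : i = i' := by
  have e := h.2.1.trans h'.2.1.symm
  by_contra hne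
  rcases Nat.lt_or_gt_of_ne hne with hlt | hlt
  · have := h.2.2 i' hlt h'.1.le
    omega
  · have := h'.2.2 i hlt h.1.le
    omega

theorem not_crossing {i i' j j' : ℕ} (h : IsArch w i i') (h' : IsArch w j j') (h1 : i < j)
    (h2 : j < i') : ¬ i' < j' := by
  intro h3
  have c1 := h.2.2 j h1 h2.le
  have c2 := h'.2.2 (i' + 1) (by omega) h3
  have := h.2.1
  omega

theorem even_pathHeight_add {k : ℕ} (hk : k ≤ m) : Even (pathHeight w k + k) := by
  induction k with
  | zero => simp
  | succ k ih =>
    obtain ⟨c, hc⟩ := ih (by omega)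
    have h1 := pathHeight_succ w k
    cases hi : w ⟨k, hk⟩ with
    | true =>
      have h2 : pathStep w k = 1 := pathStep_of_true hi
      exact ⟨c + 1, by push_cast; omega⟩
    | false =>
      have h2 : pathStep w k = -1 := pathStep_of_false hi
      exact ⟨c, by push_cast; omega⟩

/-- Height and time have the same parity, and the heights at times `i` and `j + 1` agree. This is
why the bicoloring is automatic for noncrossing arches. -/
theorem even_iff {i j : Fin m} (h : IsArch w i j) : Even (i : ℕ) ↔ ¬ Even (j : ℕ) := by
  obtain ⟨c, hc⟩ := even_pathHeight_add (w := w) i.2.le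
  obtain ⟨d, hd⟩ := even_pathHeight_add (w := w) (k := j + 1) j.2
  have := h.2.1
  rw [Nat.even_iff, Nat.even_iff]
  push_cast at hd
  omega

end IsArch

/-- Every Dyck path is the word of a noncrossing matching, whose arches join positions of different
parities. -/
theorem IsDyckPath.exists_isArchMatching {m : ℕ} {w : Fin m → Bool} (hw : IsDyckPath w) :
    ∃ a : Fin m → Fin m, IsArchMatching a ∧ archWord a = w ∧
      ∀ i, Even (a i : ℕ) ↔ ¬ Even (i : ℕ) := by
  have hex : ∀ i : Fin m, ∃ j : Fin m, IsArch w i j ∨ IsArch w j i := by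
    intro i
    cases hi : w i with
    | true => obtain ⟨j, hj⟩ := hw.exists_isArch_right hi; exact ⟨j, Or.inl hj⟩
    | false => obtain ⟨j, hj⟩ := hw.exists_isArch_left hi; exact ⟨j, Or.inr hj⟩
  choose a ha using hex
  have hlt : ∀ i, i < a i → IsArch w i (a i) := fun i hi =>
    (ha i).resolve_right fun h => hi.asymm h.1
  refine ⟨a, ⟨fun i => ?_, fun i e => ?_, fun i j h1 h2 h3 => ?_⟩, ?_, fun i => ?_⟩
  · rcases ha i with h | h <;> rcases ha (a i) with h' | h'
    · exact absurd (h'.left_eq_true.symm.trans h.right_eq_false) (by simp)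
    · exact Fin.ext (h'.left_unique h)
    · exact Fin.ext (h'.right_unique h)
    · exact absurd (h.left_eq_true.symm.trans h'.right_eq_false) (by simp)
  · have := ha i
    rw [e] at this
    rcases this with h | h <;> exact lt_irrefl _ h.1
  · exact (hlt i (h1.trans h2)).not_crossing (hlt j (h2.trans h3)) h1 h2 h3
  · funext i
    rcases ha i with h | h
    · rw [h.left_eq_true]
      exact decide_eq_true h.1
    · rw [h.right_eq_false]
      exact decide_eq_false (lt_asymm h.1)
  · rcases ha i with h | h
    · rw [h.even_iff, not_not]
    · exact h.even_iff

end DyckWords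

/-! ### Canonical labelling of the half-edges by following the loop -/

section Labelling

open CombinatorialMap Equiv Equiv.Perm

theorem minimalPeriod_eq_ncard_sameCycle {D : Type*} (p : Perm D) (d : D) :
    Function.minimalPeriod p d = {x | p.SameCycle d x}.ncard := by
  have h : {x | p.SameCycle d x} = MulAction.orbit (Subgroup.zpowers p) d := by
    ext x
    constructor
    · rintro ⟨k, rfl⟩
      exact ⟨⟨p ^ k, k, rfl⟩, rfl⟩
    · rintro ⟨⟨_, k, rfl⟩, rfl⟩
      exact ⟨k, rfl⟩
  rw [h, ← Nat.card_coe_set_eq, Nat.card_congr (MulAction.orbitZPowersEquiv p d), Nat.card_zmod]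
  rfl

theorem sameCycle_iterate {D : Type*} (p : Perm D) (d : D) (k : ℕ) : p.SameCycle d (p^[k] d) :=
  ⟨k, by rw [zpow_natCast, Perm.coe_pow]⟩

namespace RigidHamiltonianMap

variable {N : ℕ} (X : RigidHamiltonianMap N)

theorem minimalPeriod_rot (d : Fin (4 * (2 * N))) : Function.minimalPeriod X.rot d = 4 :=
  (minimalPeriod_eq_ncard_sameCycle X.rot d).trans (X.isRegular d)

theorem rot_iterate_four (d : Fin (4 * (2 * N))) : X.rot^[4] d = d := by
  have := Function.iterate_minimalPeriod (f := X.rot) (x := d)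
  rwa [minimalPeriod_rot] at this

theorem rot_rot_rot_rot (d : Fin (4 * (2 * N))) : X.rot (X.rot (X.rot (X.rot d))) = d :=
  X.rot_iterate_four d

theorem rot_iterate_injective (d : Fin (4 * (2 * N))) {i j : ℕ} (hi : i < 4) (hj : j < 4)
    (h : X.rot^[i] d = X.rot^[j] d) : i = j := by
  rwa [Function.iterate_eq_iterate_iff_of_lt_minimalPeriod] at h <;> rwa [minimalPeriod_rot]

theorem rot_rot_ne (d : Fin (4 * (2 * N))) : X.rot (X.rot d) ≠ d := fun h =>
  absurd (X.rot_iterate_injective d (i := 2) (j := 0) (by norm_num) (by norm_num) h) (by norm_num)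

theorem exists_iterate_of_sameVertex {d d' : Fin (4 * (2 * N))} (h : X.SameVertex d d') :
    ∃ j < 4, X.rot^[j] d = d' := by
  obtain ⟨k, hk⟩ := SameCycle.exists_nat_pow_eq h
  refine ⟨k % 4, Nat.mod_lt _ (by norm_num), ?_⟩
  have := Function.iterate_mod_minimalPeriod_eq (f := X.rot) (x := d) (n := k)
  rwa [minimalPeriod_rot, ← Perm.coe_pow X.rot k, hk] at this

@[simp] theorem entry_zero : X.entry 0 = X.root := rfl

theorem entry_succ (i : ℕ) : X.entry (i + 1) = X.flip (X.rot (X.rot (X.entry i))) :=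
  Function.iterate_succ_apply' _ _ _

theorem entry_mem_cycle (i : ℕ) : X.entry i ∈ X.cycle := by
  induction i with
  | zero => exact X.root_mem_cycle
  | succ i ih =>
    rw [entry_succ, X.isHamiltonianCycle.1]
    exact (X.isRigid _ ih).2

theorem entry_mem_black (i : ℕ) : X.entry i ∈ X.black ↔ Even i := by
  induction i with
  | zero => simpa using X.root_mem_black
  | succ i ih =>
    rw [entry_succ, X.isBicoloring.2, X.isBicoloring.1, X.isBicoloring.1, ih, Nat.even_add_one]

theorem rot_iterate_mem_black (d : Fin (4 * (2 * N))) (j : ℕ) :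
    X.rot^[j] d ∈ X.black ↔ d ∈ X.black := by
  induction j with
  | zero => rfl
  | succ j ih => rw [Function.iterate_succ_apply', X.isBicoloring.1, ih]

theorem rot_iterate_mem_cycle {d : Fin (4 * (2 * N))} (hd : d ∈ X.cycle) {j : ℕ} (hj : j < 4) :
    X.rot^[j] d ∈ X.cycle ↔ j = 0 ∨ j = 2 := by
  have h1 := X.isRigid d hd
  have h2 := X.isRigid _ h1.2
  interval_cases j
  · simpa using hd
  · simpa using h1.1
  · simpa using h1.2
  · simpa using h2.1

/-- The walk cannot run back along itself: if it did, moving one step inward from both ends would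
give the same coincidence with `t` lowered by one, down to a half-edge equal to its own opposite. -/
theorem entry_ne_rot_rot_entry (t j : ℕ) : X.entry j ≠ X.rot (X.rot (X.entry (j + 2 * t))) := by
  induction t generalizing j with
  | zero => exact fun h => X.rot_rot_ne _ h.symm
  | succ t ih =>
    intro h
    refine ih (j + 1) ?_
    have h1 : X.entry (j + 2 * (t + 1)) = X.flip (X.rot (X.rot (X.entry (j + 1 + 2 * t)))) := by
      rw [← entry_succ]; congr 1; ring
    rw [entry_succ, h, rot_rot_rot_rot, h1, X.flip_flip]

/-- By rigidity a visited half-edge at a vertex is the entry or its opposite. The colours force `i`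
and `i'` to have the same parity, and an even time difference rules out the opposite. -/
theorem entry_eq_of_sameVertex {i i' : ℕ} (h : X.SameVertex (X.entry i) (X.entry i')) :
    X.entry i = X.entry i' := by
  obtain ⟨j, hj, e⟩ := X.exists_iterate_of_sameVertex h
  have hc := X.entry_mem_cycle i'
  have hp : Even i' ↔ Even i := by
    rw [← X.entry_mem_black, ← X.entry_mem_black, ← e, rot_iterate_mem_black]
  rw [← e, X.rot_iterate_mem_cycle (X.entry_mem_cycle i) hj] at hc
  rcases hc with rfl | rfl
  · exact e
  · exfalso
    have e1 : X.rot (X.rot (X.entry i)) = X.entry i' := e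
    have e2 : X.rot (X.rot (X.entry i')) = X.entry i := by rw [← e1, rot_rot_rot_rot]
    rw [Nat.even_iff, Nat.even_iff] at hp
    rcases le_total i i' with hle | hle
    · refine X.entry_ne_rot_rot_entry ((i' - i) / 2) i ?_
      rw [show i + 2 * ((i' - i) / 2) = i' by omega, e2]
    · refine X.entry_ne_rot_rot_entry ((i - i') / 2) i' ?_
      rw [show i' + 2 * ((i - i') / 2) = i by omega, e1]

/-- The number of steps after which the loop closes. -/
noncomputable def period : ℕ :=
  Function.minimalPeriod (fun d => X.flip (X.rot (X.rot d))) X.root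

theorem period_pos : 0 < X.period := by
  refine Function.minimalPeriod_pos_of_mem_periodicPts ?_
  exact Function.Injective.mem_periodicPts
    (fun a b h => X.rot.injective (X.rot.injective (X.flip.injective h))) _

theorem entry_mod_period (i : ℕ) : X.entry (i % X.period) = X.entry i :=
  Function.iterate_mod_minimalPeriod_eq

theorem entry_injOn {i i' : ℕ} (hi : i < X.period) (hi' : i' < X.period)
    (h : X.entry i = X.entry i') : i = i' :=
  (Function.iterate_eq_iterate_iff_of_lt_minimalPeriod hi hi').1 h

theorem eq_of_rot_iterate_entry_eq {i i' j j' : ℕ} (hi : i < X.period) (hi' : i' < X.period)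
    (hj : j < 4) (hj' : j' < 4) (h : X.rot^[j] (X.entry i) = X.rot^[j'] (X.entry i')) :
    i = i' ∧ j = j' := by
  have hs : X.SameVertex (X.entry i) (X.entry i') :=
    (h ▸ sameCycle_iterate X.rot (X.entry i) j).trans (sameCycle_iterate _ _ _).symm
  have he := X.entry_eq_of_sameVertex hs
  rw [← he] at h
  exact ⟨X.entry_injOn hi hi' he, X.rot_iterate_injective _ hj hj' h⟩

theorem entry_period : X.entry X.period = X.root := Function.iterate_minimalPeriod

theorem flip_entry (i : ℕ) : ∃ k, X.flip (X.entry i) = X.rot (X.rot (X.entry k)) := by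
  cases i with
  | zero =>
    refine ⟨X.period - 1, ?_⟩
    have h := X.entry_succ (X.period - 1)
    rw [Nat.sub_add_cancel X.period_pos, entry_period] at h
    rw [entry_zero, h, X.flip_flip]
  | succ i => exact ⟨i, by rw [entry_succ, X.flip_flip]⟩

/-- The set of vertices met by the walk is closed under visited edges, and these edges connect all
the vertices. -/
theorem exists_sameVertex_entry (d : Fin (4 * (2 * N))) : ∃ i, X.SameVertex (X.entry i) d := by
  have h1 : ∀ x y, X.SameVertex x y → ((∃ i, X.SameVertex (X.entry i) x) ↔
      ∃ i, X.SameVertex (X.entry i) y) := fun x y hxy =>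
    ⟨fun ⟨i, hi⟩ => ⟨i, SameCycle.trans hi hxy⟩,
      fun ⟨i, hi⟩ => ⟨i, SameCycle.trans hi hxy.symm⟩⟩
  have h2 : ∀ x ∈ X.cycle, (∃ i, X.SameVertex (X.entry i) x) →
      ∃ i, X.SameVertex (X.entry i) (X.flip x) := by
    rintro x hx ⟨i, hi⟩
    obtain ⟨j, hj, rfl⟩ := X.exists_iterate_of_sameVertex hi
    rcases (X.rot_iterate_mem_cycle (X.entry_mem_cycle i) hj).1 hx with rfl | rfl
    · obtain ⟨k, hk⟩ := X.flip_entry i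
      exact ⟨k, by change X.rot.SameCycle _ (X.flip (X.entry i))
                   rw [hk]; exact sameCycle_iterate X.rot _ 2⟩
    · exact ⟨i + 1, by rw [entry_succ]; exact SameCycle.refl _ _⟩
  have key : ∀ x y, Relation.EqvGen (fun x y => X.SameVertex x y ∨ (x ∈ X.cycle ∧ y = X.flip x))
      x y → ((∃ i, X.SameVertex (X.entry i) x) ↔ ∃ i, X.SameVertex (X.entry i) y) := by
    intro x y h
    induction h with
    | rel x y h =>
      rcases h with h | ⟨hx, rfl⟩
      · exact h1 x y h
      · refine ⟨h2 x hx, fun h => ?_⟩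
        have := h2 _ ((X.isHamiltonianCycle.1 x).2 hx) h
        rwa [X.flip_flip] at this
    | refl x => exact Iff.rfl
    | symm x y _ ih => exact ih.symm
    | trans x y z _ _ ih1 ih2 => exact ih1.trans ih2
  exact (key _ _ (X.isHamiltonianCycle.2.2 X.root d)).1 ⟨0, SameCycle.refl _ _⟩

/-- During one period each vertex is entered exactly once and accounts for four half-edges; compare
with the total number of half-edges. -/
theorem period_eq : X.period = 2 * N := by
  have hb : Function.Bijective
      fun x : Fin X.period × Fin 4 => X.rot^[(x.2 : ℕ)] (X.entry x.1) := by
    constructor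
    · rintro ⟨i, j⟩ ⟨i', j'⟩ h
      obtain ⟨hi, hj⟩ := X.eq_of_rot_iterate_entry_eq i.2 i'.2 j.2 j'.2 h
      exact Prod.ext (Fin.ext hi) (Fin.ext hj)
    · intro d
      obtain ⟨i, hi⟩ := X.exists_sameVertex_entry d
      obtain ⟨j, hj, e⟩ := X.exists_iterate_of_sameVertex hi
      refine ⟨(⟨i % X.period, Nat.mod_lt _ X.period_pos⟩, ⟨j, hj⟩), ?_⟩
      simpa [entry_mod_period] using e
  have := Fintype.card_congr (Equiv.ofBijective _ hb)
  simp only [Fintype.card_prod, Fintype.card_fin] at this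
  omega

theorem label_bijective : Function.Bijective
    fun x : Fin (2 * N) × Fin 4 => X.rot^[(x.2 : ℕ)] (X.entry x.1) := by
  rw [Fintype.bijective_iff_injective_and_card]
  constructor
  · rintro ⟨i, j⟩ ⟨i', j'⟩ h
    obtain ⟨hi, hj⟩ := X.eq_of_rot_iterate_entry_eq (i.2.trans_eq X.period_eq.symm)
      (i'.2.trans_eq X.period_eq.symm) j.2 j'.2 h
    exact Prod.ext (Fin.ext hi) (Fin.ext hj)
  · simp [mul_comm]

/-- The canonical labelling of the half-edges: `(i, j)` is the `j`-th half-edge of the `i`-th vertex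
of the loop, counterclockwise from the entry of the loop. -/
noncomputable def label : Fin (2 * N) × Fin 4 ≃ Fin (4 * (2 * N)) :=
  Equiv.ofBijective _ X.label_bijective

theorem label_apply (i : Fin (2 * N)) (j : Fin 4) :
    X.label (i, j) = X.rot^[(j : ℕ)] (X.entry i) := rfl

theorem label_zero (i : Fin (2 * N)) : X.label (i, 0) = X.entry i := rfl

theorem rot_label (x : Fin (2 * N) × Fin 4) : X.rot (X.label x) = X.label (stdRot _ x) := by
  obtain ⟨i, j⟩ := x
  rw [stdRot_apply, label_apply, label_apply]
  fin_cases j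
  · rfl
  · rfl
  · rfl
  · exact X.rot_iterate_four _

theorem label_mem_cycle (i : Fin (2 * N)) (j : Fin 4) :
    X.label (i, j) ∈ X.cycle ↔ j = 0 ∨ j = 2 := by
  rw [label_apply, X.rot_iterate_mem_cycle (X.entry_mem_cycle i) j.2, Fin.ext_iff, Fin.ext_iff]
  rfl

theorem label_mem_black (i : Fin (2 * N)) (j : Fin 4) :
    X.label (i, j) ∈ X.black ↔ Even (i : ℕ) := by
  rw [label_apply, rot_iterate_mem_black, entry_mem_black]

theorem label_finRotate (i : Fin (2 * N)) :
    X.label (finRotate _ i, 0) = X.flip (X.label (i, 2)) := by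
  rw [label_zero]
  refine Eq.trans ?_ (X.entry_succ i)
  by_cases h : (i : ℕ) + 1 < 2 * N
  · rw [show i = ⟨i, i.2⟩ from rfl, finRotate_mk h]
  · have hi : (i : ℕ) + 1 = 2 * N := by omega
    have h2 := val_finRotate_eq_zero hi
    have h3 := X.entry_period
    rw [X.period_eq] at h3
    rw [h2, hi, h3, entry_zero]

/-- The involution `flip` read on the canonical labels. -/
noncomputable def code : Perm (Fin (2 * N) × Fin 4) := X.label.symm.permCongr X.flip

theorem label_code (x : Fin (2 * N) × Fin 4) : X.label (X.code x) = X.flip (X.label x) := by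
  simp [code]

theorem code_involutive : Function.Involutive X.code := fun x =>
  X.label.injective (by rw [label_code, label_code, X.flip_flip])

theorem code_ne (x : Fin (2 * N) × Fin 4) : X.code x ≠ x := fun h =>
  X.flip_ne (X.label x) (by rw [← label_code, h])

theorem code_two (i : Fin (2 * N)) : X.code (i, 2) = (finRotate _ i, 0) :=
  X.label.injective (by rw [label_code, label_finRotate])

theorem code_zero (i : Fin (2 * N)) : X.code (i, 0) = ((finRotate _).symm i, 2) := by
  rw [← X.code_involutive ((finRotate _).symm i, 2), code_two, Equiv.apply_symm_apply]

theorem code_snd_odd {x : Fin (2 * N) × Fin 4} (hx : ¬ (x.2 = 0 ∨ x.2 = 2)) :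
    ¬ ((X.code x).2 = 0 ∨ (X.code x).2 = 2) := by
  rw [← X.label_mem_cycle (X.code x).1, Prod.mk.eta, label_code, X.isHamiltonianCycle.1]
  rwa [← X.label_mem_cycle x.1, Prod.mk.eta] at hx

theorem loopFlip_apply_of_odd {n : ℕ} {x : Fin n × Fin 4} (hx : ¬ (x.2 = 0 ∨ x.2 = 2)) :
    loopFlip n x = x := by
  obtain ⟨i, j⟩ := x
  fin_cases j <;> simp at hx ⊢

/-- The unvisited part of `code`. -/
noncomputable def unvisited : Perm (Fin (2 * N) × Fin 4) := loopFlip _ * X.code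

theorem unvisited_of_even {x : Fin (2 * N) × Fin 4} (hx : x.2 = 0 ∨ x.2 = 2) :
    X.unvisited x = x := by
  obtain ⟨i, j⟩ := x
  rcases hx with h | h <;> obtain rfl : j = _ := h
  · rw [unvisited, Perm.mul_apply, code_zero, loopFlip_two, Equiv.apply_symm_apply]
  · rw [unvisited, Perm.mul_apply, code_two, loopFlip_zero, Equiv.symm_apply_apply]

theorem unvisited_of_odd {x : Fin (2 * N) × Fin 4} (hx : ¬ (x.2 = 0 ∨ x.2 = 2)) :
    X.unvisited x = X.code x :=
  loopFlip_apply_of_odd (X.code_snd_odd hx)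

theorem unvisited_involutive : Function.Involutive X.unvisited := by
  intro x
  by_cases hx : x.2 = 0 ∨ x.2 = 2
  · rw [X.unvisited_of_even hx, X.unvisited_of_even hx]
  · rw [X.unvisited_of_odd hx, X.unvisited_of_odd (X.code_snd_odd hx), X.code_involutive]

theorem rot_eq : X.rot = X.label.permCongr (stdRot _) := by
  ext d
  obtain ⟨x, rfl⟩ := X.label.surjective d
  simp [rot_label]

theorem flip_eq : X.flip = X.label.permCongr X.code := by
  ext d
  obtain ⟨x, rfl⟩ := X.label.surjective d
  simp [label_code]

end RigidHamiltonianMap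

theorem ncard_sameCycle_of_involutive {D : Type*} {p : Perm D} (hp : Function.Involutive p)
    (hne : ∀ d, p d ≠ d) (d : D) : {x | p.SameCycle d x}.ncard = 2 := by
  rw [← minimalPeriod_eq_ncard_sameCycle]
  have h2 : Function.IsPeriodicPt p 2 d := hp d
  rcases (Nat.dvd_prime Nat.prime_two).1 h2.minimalPeriod_dvd with h | h
  · exact absurd (Function.minimalPeriod_eq_one_iff_isFixedPt.1 h) (hne d)
  · exact h

namespace RigidHamiltonianMap

variable {N : ℕ} (X : RigidHamiltonianMap N)

/-- There are `2 * N` orbits of `rot` and `4 * N` of `flip`, so planarity leaves `2 * N + 2` faces,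
the extremal number for the standard loop. -/
theorem isArchSystem_unvisited (hN : 0 < N) : IsArchSystem X.unvisited := by
  have hodd : ∀ {i : Fin (2 * N)} {j : Fin 4}, ¬ (j = 0 ∨ j = 2) →
      X.unvisited (i, j) ≠ (i, j) := fun hj => by
    rw [X.unvisited_of_odd hj]; exact X.code_ne _
  refine (orbitCount_eq_iff_isArchSystem (by omega) X.unvisited_involutive
    (fun i => X.unvisited_of_even (Or.inl rfl)) (fun i => X.unvisited_of_even (Or.inr rfl))
    (fun i => hodd (by decide)) (fun i => hodd (by decide))).1 ?_
  have h1 := orbitCount_mul_eq_card X.isRegular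
  have h2 := orbitCount_mul_eq_card (ncard_sameCycle_of_involutive X.flip_flip X.flip_ne)
  have h3 := X.isPlanar.2
  -- Inserting `loopFlip * loopFlip = 1` between rotation and `code` exhibits the face permutation
  -- as that of the loop times the unvisited part.
  have h4 : X.rot * X.flip = X.label.permCongr (loopFace _ * X.unvisited) := by
    conv_lhs => rw [rot_eq, flip_eq, ← Equiv.permCongr_mul]
    rw [loopFace, unvisited, mul_assoc, ← mul_assoc (loopFlip _), loopFlip_mul_self, one_mul]
  rw [h4, orbitCount_permCongr] at h3
  rw [Fintype.card_fin] at h1 h2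
  omega

end RigidHamiltonianMap

end Labelling

/-! ### Configurations up to isomorphism as pairs of noncrossing matchings -/

section Encoding

open CombinatorialMap Equiv Equiv.Perm

theorem IsArchSystem.apply_mk {n : ℕ} {q : Perm (Fin n × Fin 4)} (hq : IsArchSystem q)
    (i : Fin n) (j : Fin 4) : ((q (i, j)).1, j) = q (i, j) :=
  Prod.ext rfl (hq.snd_apply (i, j)).symm

theorem IsArchSystem.isArchMatching {n : ℕ} {q : Perm (Fin n × Fin 4)} (hq : IsArchSystem q)
    {j : Fin 4} (hj : ∀ i, q (i, j) ≠ (i, j)) : IsArchMatching fun i => (q (i, j)).1 where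
  involutive i := by
    change (q ((q (i, j)).1, j)).1 = i
    rw [hq.apply_mk, hq.involutive]
  apply_ne i h := hj i (by rw [← hq.apply_mk, show (q (i, j)).1 = i from h])
  noncrossing i i' h1 h2 h3 := hq.noncrossing (i, j) (i', j) rfl h1 h2 h3

namespace RigidHamiltonianMap

variable {N : ℕ} (X : RigidHamiltonianMap N)

/-- The matching of the vertices of the loop by the unvisited edges on one side (`j = 1` or
`j = 3`). -/
noncomputable def arches (j : Fin 4) (i : Fin (2 * N)) : Fin (2 * N) := (X.code (i, j)).1

theorem code_odd (hN : 0 < N) {j : Fin 4} (hj : ¬ (j = 0 ∨ j = 2)) (i : Fin (2 * N)) :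
    X.code (i, j) = (X.arches j i, j) := by
  rw [arches, ← X.unvisited_of_odd hj, (X.isArchSystem_unvisited hN).apply_mk]

theorem isArchMatching_arches (hN : 0 < N) {j : Fin 4} (hj : ¬ (j = 0 ∨ j = 2)) :
    IsArchMatching (X.arches j) := by
  have h := (X.isArchSystem_unvisited hN).isArchMatching (j := j) fun i => by
    rw [X.unvisited_of_odd hj]; exact X.code_ne _
  convert h using 2 with i
  rw [X.unvisited_of_odd hj, arches]

theorem sameVertex_label (x y : Fin (2 * N) × Fin 4) :
    X.SameVertex (X.label x) (X.label y) ↔ x.1 = y.1 := by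
  obtain ⟨i, j⟩ := x
  obtain ⟨i', j'⟩ := y
  have h1 : ∀ i j, X.SameVertex (X.entry i) (X.rot^[j] (X.entry i)) := fun i j =>
    sameCycle_iterate _ _ _
  constructor
  · intro h
    have h2 := (h1 i j).trans (h.trans (h1 i' j').symm)
    have h3 := X.entry_eq_of_sameVertex h2
    exact Fin.ext (X.entry_injOn (i.2.trans_eq X.period_eq.symm)
      (i'.2.trans_eq X.period_eq.symm) h3)
  · intro h
    obtain rfl : i = i' := h
    exact (h1 i j).symm.trans (h1 i j')

theorem label_mem_firstHalf (x : Fin (2 * N) × Fin 4) :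
    X.label x ∈ X.firstHalf ↔ (x.1 : ℕ) < N := by
  constructor
  · rintro ⟨i, hi, h⟩
    have := (X.sameVertex_label (⟨i, by omega⟩, 0) x).1 h
    rw [← this]; exact hi
  · intro h
    exact ⟨x.1, h, (X.sameVertex_label (x.1, 0) x).2 rfl⟩

theorem label_mem_secondHalf (x : Fin (2 * N) × Fin 4) :
    X.label x ∈ X.secondHalf ↔ N ≤ (x.1 : ℕ) := by
  constructor
  · rintro ⟨i, hi, hi', h⟩
    have := (X.sameVertex_label (⟨i, hi'⟩, 0) x).1 h
    rw [← this]; exact hi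
  · intro h
    exact ⟨x.1, h, x.1.2, (X.sameVertex_label (x.1, 0) x).2 rfl⟩

/-- The number of contact links on both sides is the sum of the mid-heights of the two paths. -/
theorem contacts_eq (hN : 0 < N) : (X.contacts : ℤ) =
    pathHeight (archWord (X.arches 1)) N + pathHeight (archWord (X.arches 3)) N := by
  classical
  rw [(X.isArchMatching_arches hN (by decide)).pathHeight_archWord (by omega),
    (X.isArchMatching_arches hN (by decide)).pathHeight_archWord (by omega)]
  let S : Fin 4 → Finset (Fin (2 * N)) := fun j =>
    Finset.univ.filter fun i => (i : ℕ) < N ∧ N ≤ (X.arches j i : ℕ)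
  have hS : ∀ i j, i ∈ S j ↔ (i : ℕ) < N ∧ N ≤ ((X.code (i, j)).1 : ℕ) := fun i j => by
    simp only [S, Finset.mem_filter, Finset.mem_univ, true_and]
    rfl
  -- On each side the contact links are the arches from below `N` to `N` or beyond, exactly those
  -- open at the middle of the path.
  have h : {d | d ∉ X.cycle ∧ d ∈ X.firstHalf ∧ X.flip d ∈ X.secondHalf} =
      X.label '' ((((S 1) ×ˢ {1} ∪ (S 3) ×ˢ {3} : Finset (Fin (2 * N) × Fin 4))) :
        Set (Fin (2 * N) × Fin 4)) := by
    ext d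
    obtain ⟨⟨i, j⟩, rfl⟩ := X.label.surjective d
    rw [X.label.injective.mem_set_image]
    simp only [Set.mem_ofPred_eq, label_mem_cycle, label_mem_firstHalf, ← label_code,
      label_mem_secondHalf, Finset.mem_coe, Finset.mem_union, Finset.mem_product,
      Finset.mem_singleton, hS]
    fin_cases j <;> simp
  rw [contacts, h, Set.ncard_image_of_injective _ X.label.injective, Set.ncard_coe_finset,
    Finset.card_union_of_disjoint]
  · simp [S]
  · rw [Finset.disjoint_left]
    rintro ⟨i, j⟩ h1 h3
    rw [Finset.mem_product, Finset.mem_singleton] at h1 h3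
    exact absurd (h1.2.symm.trans h3.2) (by decide)

/-- Matching the canonical labels transports everything: rotation, colours, cycle and root are the
same for all configurations in these labels, so only `code` has to be compared. -/
theorem iso_of_code_eq (hN : 0 < N) {X Y : RigidHamiltonianMap N} (h : X.code = Y.code) :
    X.Iso Y := by
  have hf : ∀ x, (X.label.symm.trans Y.label) (X.label x) = Y.label x := fun x => by simp
  refine ⟨X.label.symm.trans Y.label, fun d => ?_, fun d => ?_, fun d => ?_, fun d => ?_, ?_⟩
  · obtain ⟨x, rfl⟩ := X.label.surjective d
    rw [hf, rot_label, rot_label, hf]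
  · obtain ⟨x, rfl⟩ := X.label.surjective d
    rw [hf, ← label_code, ← label_code, hf, h]
  · obtain ⟨⟨i, j⟩, rfl⟩ := X.label.surjective d
    rw [hf, label_mem_black, label_mem_black]
  · obtain ⟨⟨i, j⟩, rfl⟩ := X.label.surjective d
    rw [hf, label_mem_cycle, label_mem_cycle]
  · exact hf (⟨0, by omega⟩, 0)

theorem code_eq_of_iso {X Y : RigidHamiltonianMap N} (h : X.Iso Y) : X.code = Y.code := by
  obtain ⟨f, h1, h2, -, -, h5⟩ := h
  have he : ∀ i, f (X.entry i) = Y.entry i := by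
    intro i
    induction i with
    | zero => exact h5
    | succ i ih => rw [entry_succ, entry_succ, h2, h1, h1, ih]
  have hl : ∀ x, f (X.label x) = Y.label x := by
    rintro ⟨i, j⟩
    rw [label_apply, label_apply, ← he]
    generalize (j : ℕ) = k
    induction k with
    | zero => rfl
    | succ k ih => rw [Function.iterate_succ_apply', Function.iterate_succ_apply', h1, ih]
  ext1 x
  apply Y.label.injective
  rw [label_code, ← hl, label_code, h2, hl]

theorem code_eq_of_arches_eq (hN : 0 < N) {X Y : RigidHamiltonianMap N}
    (h1 : X.arches 1 = Y.arches 1) (h3 : X.arches 3 = Y.arches 3) : X.code = Y.code := by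
  ext1 ⟨i, j⟩
  fin_cases j
  · exact (X.code_zero i).trans (Y.code_zero i).symm
  · exact ((X.code_odd hN (by decide) i).trans (congrArg (fun a => (a i, (1 : Fin 4))) h1)).trans
      (Y.code_odd hN (by decide) i).symm
  · exact (X.code_two i).trans (Y.code_two i).symm
  · exact ((X.code_odd hN (by decide) i).trans (congrArg (fun a => (a i, (3 : Fin 4))) h3)).trans
      (Y.code_odd hN (by decide) i).symm

end RigidHamiltonianMap

/-- The underlying function of `archPerm`. -/
def archPermFun {n : ℕ} (a b : Fin n → Fin n) (x : Fin n × Fin 4) : Fin n × Fin 4 :=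
  if x.2 = 1 then (a x.1, 1) else if x.2 = 3 then (b x.1, 3) else x

theorem archPermFun_involutive {n : ℕ} {a b : Fin n → Fin n} (ha : Function.Involutive a)
    (hb : Function.Involutive b) : Function.Involutive (archPermFun a b) := by
  rintro ⟨i, j⟩
  fin_cases j <;> simp [archPermFun, ha i, hb i]

/-- The involution of the half-edges given by the matching `a` on the side of the half-edges
`(i, 1)` of the loop and by the matching `b` on the other side. -/
def archPerm {n : ℕ} {a b : Fin n → Fin n} (ha : IsArchMatching a) (hb : IsArchMatching b) :
    Perm (Fin n × Fin 4) :=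
  (archPermFun_involutive ha.involutive hb.involutive).toPerm

section ArchPerm

variable {n : ℕ} {a b : Fin n → Fin n} (ha : IsArchMatching a) (hb : IsArchMatching b)

theorem archPerm_zero (i : Fin n) : archPerm ha hb (i, 0) = (i, 0) := rfl

theorem archPerm_two (i : Fin n) : archPerm ha hb (i, 2) = (i, 2) := rfl

theorem isArchSystem_archPerm : IsArchSystem (archPerm ha hb) where
  involutive := archPermFun_involutive ha.involutive hb.involutive
  snd_apply := by
    rintro ⟨i, j⟩
    fin_cases j <;> rfl
  apply_zero _ := rfl
  apply_two _ := rfl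
  noncrossing := by
    rintro ⟨i, j⟩ ⟨i', j'⟩ h
    obtain rfl : j = j' := h
    fin_cases j
    · exact fun h1 h2 => absurd h1 h2.asymm
    · exact ha.noncrossing i i'
    · exact fun h1 h2 => absurd h1 h2.asymm
    · exact hb.noncrossing i i'

/-- The involution `flip` of the map with arches `a` and `b`. -/
def modelFlip : Perm (Fin n × Fin 4) := loopFlip n * archPerm ha hb

theorem modelFlip_zero (i : Fin n) : modelFlip ha hb (i, 0) = ((finRotate n).symm i, 2) := rfl

theorem modelFlip_one (i : Fin n) : modelFlip ha hb (i, 1) = (a i, 1) := rfl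

theorem modelFlip_two (i : Fin n) : modelFlip ha hb (i, 2) = (finRotate n i, 0) := rfl

theorem modelFlip_three (i : Fin n) : modelFlip ha hb (i, 3) = (b i, 3) := rfl

theorem modelFlip_involutive : Function.Involutive (modelFlip ha hb) := by
  rintro ⟨i, j⟩
  fin_cases j
  · change modelFlip ha hb (modelFlip ha hb (i, 0)) = (i, 0)
    rw [modelFlip_zero, modelFlip_two, Equiv.apply_symm_apply]
  · change modelFlip ha hb (modelFlip ha hb (i, 1)) = (i, 1)
    rw [modelFlip_one, modelFlip_one, ha.involutive]
  · change modelFlip ha hb (modelFlip ha hb (i, 2)) = (i, 2)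
    rw [modelFlip_two, modelFlip_zero, Equiv.symm_apply_apply]
  · change modelFlip ha hb (modelFlip ha hb (i, 3)) = (i, 3)
    rw [modelFlip_three, modelFlip_three, hb.involutive]

theorem modelFlip_ne (x : Fin n × Fin 4) : modelFlip ha hb x ≠ x := by
  obtain ⟨i, j⟩ := x
  intro h
  fin_cases j
  · exact absurd (congrArg Prod.snd h) (by decide : (2 : Fin 4) ≠ 0)
  · exact ha.apply_ne i (congrArg Prod.fst h)
  · exact absurd (congrArg Prod.snd h) (by decide : (0 : Fin 4) ≠ 2)
  · exact hb.apply_ne i (congrArg Prod.fst h)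

theorem sameCycle_stdRot (x y : Fin n × Fin 4) : (stdRot n).SameCycle x y ↔ x.1 = y.1 := by
  constructor
  · intro h
    exact (sameCycle_mem_of_forall_mem (S := {z : Fin n × Fin 4 | z.1 = x.1})
      (fun z hz => hz) h (rfl : x.1 = x.1) : y.1 = x.1).symm
  · obtain ⟨i, j⟩ := x
    obtain ⟨i', j'⟩ := y
    intro h
    obtain rfl : i = i' := h
    have key : ∀ j : Fin 4, (stdRot n).SameCycle (i, 0) (i, j) := by
      intro j
      fin_cases j
      · exact SameCycle.refl _ _
      · exact sameCycle_iterate (stdRot n) (i, 0) 1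
      · exact sameCycle_iterate (stdRot n) (i, 0) 2
      · exact sameCycle_iterate (stdRot n) (i, 0) 3
    exact (key j).symm.trans (key j')

theorem orbitCount_model (hn : 0 < n) : orbitCount (stdRot n * modelFlip ha hb) = n + 2 := by
  rw [modelFlip, ← mul_assoc]
  exact (orbitCount_eq_iff_isArchSystem hn (isArchSystem_archPerm ha hb).involutive
    (archPerm_zero ha hb) (archPerm_two ha hb)
    (fun i h => ha.apply_ne i (congrArg Prod.fst h))
    (fun i h => hb.apply_ne i (congrArg Prod.fst h))).2 (isArchSystem_archPerm ha hb)

end ArchPerm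

/-- The closing edge of the loop, from the last vertex to vertex `0`, also changes colour because
the number of vertices is even. -/
theorem even_finRotate {N : ℕ} (i : Fin (2 * N)) :
    Even ((finRotate _ i : Fin (2 * N)) : ℕ) ↔ ¬ Even (i : ℕ) := by
  by_cases h : (i : ℕ) + 1 < 2 * N
  · conv_lhs => rw [show i = ⟨i, i.2⟩ from rfl, finRotate_mk h]
    exact Nat.even_add_one
  · have hi : (i : ℕ) + 1 = 2 * N := by omega
    have h2 := val_finRotate_eq_zero hi
    rw [h2]
    simp only [Even.zero, true_iff, Nat.not_even_iff]
    omega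

end Encoding

/-! ### Realisation of every pair of Dyck paths by a configuration -/

section Model

open CombinatorialMap Equiv Equiv.Perm

/-- An arbitrary numbering of the half-edges of the model. -/
noncomputable def modelEquiv (N : ℕ) : Fin (2 * N) × Fin 4 ≃ Fin (4 * (2 * N)) :=
  Fintype.equivOfCardEq (by simp [mul_comm])

/-- Reduces connectedness of the map to connectedness along its Hamiltonian cycle. -/
theorem CombinatorialMap.exists_mem_closure_of_eqvGen {D : Type*} (m : CombinatorialMap D)
    {r : D → D → Prop} (hr : ∀ x y, r x y → m.SameVertex x y ∨ y = m.flip x) {d d' : D}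
    (h : Relation.EqvGen r d d') :
    ∃ g ∈ Subgroup.closure ({m.rot, m.flip} : Set (Perm D)), g d = d' := by
  have h1 : m.rot ∈ Subgroup.closure ({m.rot, m.flip} : Set (Perm D)) :=
    Subgroup.subset_closure (by simp)
  have h2 : m.flip ∈ Subgroup.closure ({m.rot, m.flip} : Set (Perm D)) :=
    Subgroup.subset_closure (by simp)
  induction h with
  | rel x y h =>
    rcases hr x y h with ⟨k, hk⟩ | h
    · exact ⟨_, Subgroup.zpow_mem _ h1 k, hk⟩
    · exact ⟨_, h2, h.symm⟩
  | refl x => exact ⟨1, Subgroup.one_mem _, rfl⟩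
  | symm x y _ ih =>
    obtain ⟨g, hg, rfl⟩ := ih
    exact ⟨g⁻¹, Subgroup.inv_mem _ hg, by simp⟩
  | trans x y z _ _ ih1 ih2 =>
    obtain ⟨g, hg, rfl⟩ := ih1
    obtain ⟨g', hg', rfl⟩ := ih2
    exact ⟨g' * g, Subgroup.mul_mem _ hg' hg, rfl⟩

variable {N : ℕ} {a b : Fin (2 * N) → Fin (2 * N)} (ha : IsArchMatching a) (hb : IsArchMatching b)

/-- The combinatorial map formed by a loop with arches `a` and `b` on its two sides. -/
noncomputable def modelMap : CombinatorialMap (Fin (4 * (2 * N))) where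
  rot := (modelEquiv N).permCongr (stdRot _)
  flip := (modelEquiv N).permCongr (modelFlip ha hb)
  flip_flip d := by simp [modelFlip_involutive ha hb _]
  flip_ne d h := by
    obtain ⟨x, rfl⟩ := (modelEquiv N).surjective d
    simp only [Equiv.permCongr_apply, Equiv.symm_apply_apply, EmbeddingLike.apply_eq_iff_eq] at h
    exact modelFlip_ne ha hb x h

theorem modelMap_rot (x : Fin (2 * N) × Fin 4) :
    (modelMap ha hb).rot (modelEquiv N x) = modelEquiv N (stdRot _ x) := by simp [modelMap]

theorem modelMap_flip (x : Fin (2 * N) × Fin 4) :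
    (modelMap ha hb).flip (modelEquiv N x) = modelEquiv N (modelFlip ha hb x) := by
  simp [modelMap]

theorem modelMap_sameVertex (x y : Fin (2 * N) × Fin 4) :
    (modelMap ha hb).SameVertex (modelEquiv N x) (modelEquiv N y) ↔ x.1 = y.1 :=
  (sameCycle_permCongr_iff _ _ _ _).trans (sameCycle_stdRot x y)

theorem modelMap_isRegular : (modelMap ha hb).IsRegular 4 := by
  intro d
  obtain ⟨⟨i, j⟩, rfl⟩ := (modelEquiv N).surjective d
  have : {x | (modelMap ha hb).SameVertex (modelEquiv N (i, j)) x} =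
      modelEquiv N '' (({i} ×ˢ Finset.univ : Finset (Fin (2 * N) × Fin 4)) : Set _) := by
    ext d
    obtain ⟨⟨i', j'⟩, rfl⟩ := (modelEquiv N).surjective d
    rw [(modelEquiv N).injective.mem_set_image, Set.mem_ofPred_eq, modelMap_sameVertex]
    simp [eq_comm]
  rw [this, Set.ncard_image_of_injective _ (modelEquiv N).injective, Set.ncard_coe_finset]
  simp

/-- The half-edges of the loop of the model. -/
def modelCycle (N : ℕ) : Set (Fin (4 * (2 * N))) :=
  modelEquiv N '' {x | x.2 = 0 ∨ x.2 = 2}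

/-- The half-edges at the black vertices of the model. -/
def modelBlack (N : ℕ) : Set (Fin (4 * (2 * N))) :=
  modelEquiv N '' {x | Even (x.1 : ℕ)}

theorem mem_modelCycle (x : Fin (2 * N) × Fin 4) :
    modelEquiv N x ∈ modelCycle N ↔ x.2 = 0 ∨ x.2 = 2 :=
  (modelEquiv N).injective.mem_set_image

theorem mem_modelBlack (x : Fin (2 * N) × Fin 4) :
    modelEquiv N x ∈ modelBlack N ↔ Even (x.1 : ℕ) :=
  (modelEquiv N).injective.mem_set_image

theorem modelMap_isBicoloring (ha' : ∀ i, Even (a i : ℕ) ↔ ¬ Even (i : ℕ))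
    (hb' : ∀ i, Even (b i : ℕ) ↔ ¬ Even (i : ℕ)) :
    (modelMap ha hb).IsBicoloring (modelBlack N) := by
  constructor
  · intro d
    obtain ⟨x, rfl⟩ := (modelEquiv N).surjective d
    rw [modelMap_rot, mem_modelBlack, mem_modelBlack]
    rfl
  · intro d
    obtain ⟨⟨i, j⟩, rfl⟩ := (modelEquiv N).surjective d
    rw [modelMap_flip, mem_modelBlack, mem_modelBlack]
    fin_cases j
    · have := even_finRotate ((finRotate _).symm i)
      rw [Equiv.apply_symm_apply] at this
      change Even (((finRotate _).symm i : Fin (2 * N)) : ℕ) ↔ ¬ Even (i : ℕ)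
      rw [this, not_not]
    · exact ha' i
    · exact even_finRotate i
    · exact hb' i

theorem modelMap_isHamiltonianCycle : (modelMap ha hb).IsHamiltonianCycle (modelCycle N) := by
  refine ⟨fun d => ?_, fun d => ?_, fun d d' => ?_⟩
  · obtain ⟨⟨i, j⟩, rfl⟩ := (modelEquiv N).surjective d
    rw [modelMap_flip, mem_modelCycle, mem_modelCycle]
    fin_cases j
    · simp [modelFlip_zero]
    · simp [modelFlip_one]
    · simp [modelFlip_two]
    · simp [modelFlip_three]
  · obtain ⟨⟨i, j⟩, rfl⟩ := (modelEquiv N).surjective d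
    have : {x | (modelMap ha hb).SameVertex (modelEquiv N (i, j)) x ∧ x ∈ modelCycle N} =
        modelEquiv N '' (({i} ×ˢ {0, 2} : Finset (Fin (2 * N) × Fin 4)) : Set _) := by
      ext d
      obtain ⟨⟨i', j'⟩, rfl⟩ := (modelEquiv N).surjective d
      rw [(modelEquiv N).injective.mem_set_image, Set.mem_ofPred_eq, modelMap_sameVertex,
        mem_modelCycle]
      simp [eq_comm, and_or_left]
    rw [this, Set.ncard_image_of_injective _ (modelEquiv N).injective, Set.ncard_coe_finset]
    simp
  · set r : Fin (4 * (2 * N)) → Fin (4 * (2 * N)) → Prop := fun x y =>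
      (modelMap ha hb).SameVertex x y ∨ (x ∈ modelCycle N ∧ y = (modelMap ha hb).flip x)
    have hv : ∀ i j j', Relation.EqvGen r (modelEquiv N (i, j)) (modelEquiv N (i, j')) :=
      fun i j j' => .rel _ _ (Or.inl ((modelMap_sameVertex ha hb _ _).2 rfl))
    have h0 : ∀ (k : ℕ) (hk : k < 2 * N),
        Relation.EqvGen r (modelEquiv N (⟨0, by omega⟩, 0)) (modelEquiv N (⟨k, hk⟩, 0)) := by
      intro k
      induction k with
      | zero => exact fun _ => .refl _
      | succ k ih =>
        intro hk
        refine ((ih (by omega)).trans _ _ _ (hv _ 0 2)).trans _ _ _ (.rel _ _ (Or.inr ⟨?_, ?_⟩))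
        · rw [mem_modelCycle]; exact Or.inr rfl
        · rw [modelMap_flip, modelFlip_two, finRotate_mk hk]
    have key : ∀ d, ∃ h, Relation.EqvGen r (modelEquiv N (⟨0, h⟩, 0)) d := by
      intro d
      obtain ⟨⟨i, j⟩, rfl⟩ := (modelEquiv N).surjective d
      exact ⟨by have := i.2; omega, (h0 i i.2).trans _ _ _ (hv _ 0 j)⟩
    obtain ⟨_, h1⟩ := key d
    obtain ⟨_, h2⟩ := key d'
    exact (h1.symm _ _).trans _ _ _ h2

theorem modelMap_isRigid : (modelMap ha hb).IsRigid (modelCycle N) := by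
  intro d
  obtain ⟨⟨i, j⟩, rfl⟩ := (modelEquiv N).surjective d
  rw [modelMap_rot, modelMap_rot, mem_modelCycle, mem_modelCycle, mem_modelCycle, stdRot_apply,
    stdRot_apply]
  exact (by decide : ∀ j : Fin 4, j = 0 ∨ j = 2 →
    ¬ (j + 1 = 0 ∨ j + 1 = 2) ∧ (j + 1 + 1 = 0 ∨ j + 1 + 1 = 2)) j

theorem modelMap_isPlanar (hN : 0 < N) : (modelMap ha hb).IsPlanar := by
  refine ⟨fun d d' => (modelMap ha hb).exists_mem_closure_of_eqvGen
    (fun x y h => h.imp id And.right) ((modelMap_isHamiltonianCycle ha hb).2.2 d d'), ?_⟩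
  have h1 := orbitCount_mul_eq_card (modelMap_isRegular ha hb)
  have h2 := orbitCount_mul_eq_card
    (ncard_sameCycle_of_involutive (modelMap ha hb).flip_flip (modelMap ha hb).flip_ne)
  have h3 : orbitCount ((modelMap ha hb).rot * (modelMap ha hb).flip) = 2 * N + 2 := by
    rw [← orbitCount_model ha hb (by omega), modelMap, ← Equiv.permCongr_mul,
      orbitCount_permCongr]
  rw [Fintype.card_fin] at h1 h2
  omega

/-- The configuration with arches `a` and `b` on the two sides of the loop. -/
noncomputable def model (hN : 0 < N) (ha' : ∀ i, Even (a i : ℕ) ↔ ¬ Even (i : ℕ))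
    (hb' : ∀ i, Even (b i : ℕ) ↔ ¬ Even (i : ℕ)) : RigidHamiltonianMap N where
  toCombinatorialMap := modelMap ha hb
  isPlanar := modelMap_isPlanar ha hb hN
  isRegular := modelMap_isRegular ha hb
  black := modelBlack N
  isBicoloring := modelMap_isBicoloring ha hb ha' hb'
  cycle := modelCycle N
  isHamiltonianCycle := modelMap_isHamiltonianCycle ha hb
  isRigid := modelMap_isRigid ha hb
  root := modelEquiv N (⟨0, by omega⟩, 0)
  root_mem_cycle := (mem_modelCycle _).2 (Or.inl rfl)
  root_mem_black := (mem_modelBlack _).2 (by simp)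

section

variable (hN : 0 < N) (ha' : ∀ i, Even (a i : ℕ) ↔ ¬ Even (i : ℕ))
    (hb' : ∀ i, Even (b i : ℕ) ↔ ¬ Even (i : ℕ))

theorem model_rot (x : Fin (2 * N) × Fin 4) :
    (model ha hb hN ha' hb').rot (modelEquiv N x) = modelEquiv N (stdRot _ x) :=
  modelMap_rot ha hb x

theorem model_flip (x : Fin (2 * N) × Fin 4) :
    (model ha hb hN ha' hb').flip (modelEquiv N x) = modelEquiv N (modelFlip ha hb x) :=
  modelMap_flip ha hb x

theorem model_entry {i : ℕ} (hi : i < 2 * N) :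
    (model ha hb hN ha' hb').entry i = modelEquiv N (⟨i, hi⟩, 0) := by
  induction i with
  | zero => rfl
  | succ i ih =>
    rw [RigidHamiltonianMap.entry_succ, ih (by omega), model_rot, model_rot, model_flip,
      stdRot_apply, stdRot_apply, ← finRotate_mk hi]
    rfl

/-- The walk from the root meets the vertices of the model in their order, so the canonical
labelling is the numbering used to build it, and the arches can be read back unchanged. -/
theorem model_label : (model ha hb hN ha' hb').label = modelEquiv N := by
  ext1 ⟨i, j⟩
  rw [RigidHamiltonianMap.label_apply, model_entry ha hb hN ha' hb' i.2]
  fin_cases j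
  · rfl
  · exact model_rot ha hb hN ha' hb' _
  · exact (congrArg _ (model_rot ha hb hN ha' hb' _)).trans (model_rot ha hb hN ha' hb' _)
  · exact (congrArg _ ((congrArg _ (model_rot ha hb hN ha' hb' _)).trans
      (model_rot ha hb hN ha' hb' _))).trans (model_rot ha hb hN ha' hb' _)

theorem model_code : (model ha hb hN ha' hb').code = modelFlip ha hb := by
  ext1 x
  apply (modelEquiv N).injective
  rw [← model_flip ha hb hN ha' hb', ← model_label ha hb hN ha' hb',
    RigidHamiltonianMap.label_code]

theorem model_arches_one : (model ha hb hN ha' hb').arches 1 = a := by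
  funext i
  rw [RigidHamiltonianMap.arches, model_code, modelFlip_one]

theorem model_arches_three : (model ha hb hN ha' hb').arches 3 = b := by
  funext i
  rw [RigidHamiltonianMap.arches, model_code, modelFlip_three]

end

namespace RigidConfig

/-- The pair of Dyck paths describing the two sides of a configuration. -/
noncomputable def words (N : ℕ) (hN : 0 < N) (c : RigidConfig N) :
    {w : Fin (2 * N) → Bool // IsDyckPath w} × {w : Fin (2 * N) → Bool // IsDyckPath w} :=
  Quotient.lift (fun X : RigidHamiltonianMap N =>
    ((⟨archWord (X.arches 1), (X.isArchMatching_arches hN (by decide)).isDyckPath⟩,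
      ⟨archWord (X.arches 3), (X.isArchMatching_arches hN (by decide)).isDyckPath⟩) :
      {w : Fin (2 * N) → Bool // IsDyckPath w} × {w : Fin (2 * N) → Bool // IsDyckPath w}))
    (fun X Y h => by
      have hc : X.code = Y.code := RigidHamiltonianMap.code_eq_of_iso h
      have : X.arches = Y.arches := by
        funext j i
        rw [RigidHamiltonianMap.arches, RigidHamiltonianMap.arches, hc]
      simp only [this]) c

/-- Injectivity: the words determine the matchings, these determine `code`, and `code` determines
the isomorphism class. Surjectivity: the matchings of two Dyck paths have the parity property that
the model requires. -/
theorem words_bijective (N : ℕ) (hN : 0 < N) : Function.Bijective (words N hN) := by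
  constructor
  · intro u v
    induction u using Quotient.inductionOn with | _ X
    induction v using Quotient.inductionOn with | _ Y
    intro h
    have h1 : archWord (X.arches 1) = archWord (Y.arches 1) :=
      congrArg (fun p => p.1.1) h
    have h3 : archWord (X.arches 3) = archWord (Y.arches 3) :=
      congrArg (fun p => p.2.1) h
    exact Quotient.sound (RigidHamiltonianMap.iso_of_code_eq hN
      (RigidHamiltonianMap.code_eq_of_arches_eq hN
        ((X.isArchMatching_arches hN (by decide)).eq_of_archWord_eq
          (Y.isArchMatching_arches hN (by decide)) h1)
        ((X.isArchMatching_arches hN (by decide)).eq_of_archWord_eq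
          (Y.isArchMatching_arches hN (by decide)) h3)))
  · rintro ⟨⟨w, hw⟩, ⟨w', hw'⟩⟩
    obtain ⟨a, ha, rfl, ha'⟩ := hw.exists_isArchMatching
    obtain ⟨b, hb, rfl, hb'⟩ := hw'.exists_isArchMatching
    refine ⟨Quotient.mk _ (model ha hb hN ha' hb'), ?_⟩
    refine Prod.ext (Subtype.ext ?_) (Subtype.ext ?_)
    · exact congrArg archWord (model_arches_one ha hb hN ha' hb')
    · exact congrArg archWord (model_arches_three ha hb hN ha' hb')

theorem contacts_eq {N : ℕ} (hN : 0 < N) (c : RigidConfig N) : (c.contacts : ℤ) =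
    pathHeight (words N hN c).1.1 N + pathHeight (words N hN c).2.1 N := by
  induction c using Quotient.inductionOn with | _ X
  exact X.contacts_eq hN

end RigidConfig

end Model

/-! ### Ballot numbers and the weighted sum of their squares -/

section Counting

theorem pathStep_cons_zero {m : ℕ} (b : Bool) (w : Fin m → Bool) :
    pathStep (Fin.cons b w : Fin (m + 1) → Bool) 0 = if b then 1 else -1 := by
  simp [pathStep]

theorem pathStep_cons_succ {m : ℕ} (b : Bool) (w : Fin m → Bool) (i : ℕ) :
    pathStep (Fin.cons b w : Fin (m + 1) → Bool) (i + 1) = pathStep w i := by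
  unfold pathStep
  by_cases h : i < m
  · rw [dif_pos h, dif_pos (Nat.succ_lt_succ h)]
    rfl
  · rw [dif_neg h, dif_neg (by omega)]

theorem pathHeight_cons_succ {m : ℕ} (b : Bool) (w : Fin m → Bool) (k : ℕ) :
    pathHeight (Fin.cons b w : Fin (m + 1) → Bool) (k + 1) =
      (if b then 1 else -1) + pathHeight w k := by
  unfold pathHeight
  rw [Finset.sum_range_succ', pathStep_cons_zero, add_comm]
  simp only [pathStep_cons_succ]

/-- Nonnegative paths from height `a` to height `0`. -/
def IsPathFrom {m : ℕ} (a : ℕ) (w : Fin m → Bool) : Prop :=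
  (∀ k ≤ m, 0 ≤ a + pathHeight w k) ∧ a + pathHeight w m = 0

theorem isPathFrom_zero_iff {m : ℕ} (w : Fin m → Bool) : IsPathFrom 0 w ↔ IsDyckPath w := by
  simp [IsPathFrom, IsDyckPath]

theorem isPathFrom_cons_true {m : ℕ} (a : ℕ) (w : Fin m → Bool) :
    IsPathFrom a (Fin.cons true w : Fin (m + 1) → Bool) ↔ IsPathFrom (a + 1) w := by
  unfold IsPathFrom
  rw [pathHeight_cons_succ]
  constructor
  · rintro ⟨h1, h2⟩
    refine ⟨fun k hk => ?_, ?_⟩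
    · have := h1 (k + 1) (by omega)
      rw [pathHeight_cons_succ] at this
      simp at this; push_cast; linarith
    · simp at h2; push_cast; linarith
  · rintro ⟨h1, h2⟩
    refine ⟨fun k hk => ?_, ?_⟩
    · cases k with
      | zero => simp
      | succ k =>
        have := h1 k (by omega)
        rw [pathHeight_cons_succ]
        push_cast at this; simp; linarith
    · push_cast at h2; simp; linarith

theorem not_isPathFrom_zero_cons_false {m : ℕ} (w : Fin m → Bool) :
    ¬ IsPathFrom 0 (Fin.cons false w : Fin (m + 1) → Bool) := by
  intro h
  have := h.1 (0 + 1) (by omega)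
  rw [pathHeight_cons_succ] at this
  simp at this

theorem isPathFrom_succ_cons_false {m : ℕ} (a : ℕ) (w : Fin m → Bool) :
    IsPathFrom (a + 1) (Fin.cons false w : Fin (m + 1) → Bool) ↔ IsPathFrom a w := by
  unfold IsPathFrom
  rw [pathHeight_cons_succ]
  constructor
  · rintro ⟨h1, h2⟩
    refine ⟨fun k hk => ?_, ?_⟩
    · have := h1 (k + 1) (by omega)
      rw [pathHeight_cons_succ] at this
      simp at this; linarith
    · simp at h2; linarith
  · rintro ⟨h1, h2⟩
    refine ⟨fun k hk => ?_, ?_⟩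
    · cases k with
      | zero => simp; positivity
      | succ k =>
        have := h1 k (by omega)
        rw [pathHeight_cons_succ]
        simp; linarith
    · simp; linarith

/-- The transfer operator of nonnegative paths. -/
def pathTransfer (f : ℕ → ℤ) : ℕ → ℤ
  | 0 => f 1
  | a + 1 => f (a + 2) + f a

/-- The number of nonnegative paths of length `n` from height `a` to height `0`. -/
def ballot (n : ℕ) : ℕ → ℤ := pathTransfer^[n] fun a => if a = 0 then 1 else 0

theorem ballot_succ_zero (n : ℕ) : ballot (n + 1) 0 = ballot n 1 := by
  rw [ballot, Function.iterate_succ_apply']; rfl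

theorem ballot_succ_succ (n a : ℕ) :
    ballot (n + 1) (a + 1) = ballot n (a + 2) + ballot n a := by
  rw [ballot, Function.iterate_succ_apply']; rfl

open Classical in
theorem sum_isPathFrom_succ {m : ℕ} (F : (Fin (m + 1) → Bool) → ℤ) (a : ℕ) :
    ∑ w, (if IsPathFrom a w then F w else 0) =
      ∑ w, (if IsPathFrom a (Fin.cons true w : Fin (m + 1) → Bool) then F (Fin.cons true w) else 0) +
      ∑ w, (if IsPathFrom a (Fin.cons false w : Fin (m + 1) → Bool)
        then F (Fin.cons false w) else 0) := by
  rw [← (Fin.consEquiv fun _ => Bool).sum_comp, Fintype.sum_prod_type, Fintype.sum_bool]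
  rfl

open Classical in
/-- Counting paths with a weight depending on the height after `n` steps. -/
theorem sum_isPathFrom (f : ℤ → ℤ) (n k a : ℕ) :
    ∑ w : Fin (k + n) → Bool, (if IsPathFrom a w then f (a + pathHeight w n) else 0) =
      pathTransfer^[n] (fun b => f b * ∑ w : Fin k → Bool, if IsPathFrom b w then 1 else 0) a := by
  induction n generalizing a with
  | zero =>
    change _ = f a * _
    rw [Finset.mul_sum]
    simp
  | succ n ih =>
    rw [Function.iterate_succ_apply']
    refine (sum_isPathFrom_succ (m := k + n) _ a).trans ?_
    simp only [isPathFrom_cons_true, pathHeight_cons_succ]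
    cases a with
    | zero =>
      simp only [not_isPathFrom_zero_cons_false, if_false, Finset.sum_const_zero, add_zero]
      refine Eq.trans ?_ (ih 1)
      simp
    | succ a =>
      simp only [isPathFrom_succ_cons_false]
      refine Eq.trans ?_ (congrArg₂ (· + ·) (ih (a + 2)) (ih a))
      congr 1
      · refine Finset.sum_congr rfl fun w _ => ?_
        congr 2
        push_cast; ring
      · refine Finset.sum_congr rfl fun w _ => ?_
        congr 2
        push_cast; ring

open Classical in
theorem sum_isPathFrom_one (n a : ℕ) :
    ∑ w : Fin n → Bool, (if IsPathFrom a w then 1 else 0) = ballot n a := by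
  have h0 : ∀ b : ℕ, ∑ w : Fin 0 → Bool, (if IsPathFrom b w then (1 : ℤ) else 0) =
      if b = 0 then 1 else 0 := by
    intro b
    simp [IsPathFrom]
  have h := sum_isPathFrom (fun _ => 1) n 0 a
  simp only [h0, one_mul] at h
  rw [ballot, ← h, Nat.zero_add]

theorem ballot_eq_zero_of_lt {n a : ℕ} (h : n < a) : ballot n a = 0 := by
  induction n generalizing a with
  | zero =>
    change (if a = 0 then (1 : ℤ) else 0) = 0
    rw [if_neg h.ne']
  | succ n ih =>
    obtain ⟨a, rfl⟩ : ∃ b, a = b + 1 := ⟨a - 1, by omega⟩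
    rw [ballot_succ_succ, ih (by omega), ih (by omega), add_zero]

theorem ballot_eq_zero_of_odd {n a : ℕ} (h : Odd (n + a)) : ballot n a = 0 := by
  induction n generalizing a with
  | zero =>
    change (if a = 0 then (1 : ℤ) else 0) = 0
    rw [if_neg]
    rintro rfl
    simp at h
  | succ n ih =>
    rw [Nat.odd_iff] at h
    cases a with
    | zero => rw [ballot_succ_zero, ih (by rw [Nat.odd_iff]; omega)]
    | succ a =>
      rw [ballot_succ_succ, ih (by rw [Nat.odd_iff]; omega), ih (by rw [Nat.odd_iff]; omega),
        add_zero]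

/-- This is the reflection formula `C(n, k) - C(n, k - 1)`, where `k` counts the up-steps, rewritten
by Pascal's rule so that `k = 0` needs no special convention. -/
theorem ballot_eq {n a k : ℕ} (h : a + 2 * k = n) :
    ballot n a = 2 * (n.choose k : ℤ) - ((n + 1).choose k : ℤ) := by
  induction n generalizing a k with
  | zero =>
    obtain rfl : a = 0 := by omega
    obtain rfl : k = 0 := by omega
    rfl
  | succ n ih =>
    cases k with
    | zero =>
      obtain rfl : a = n + 1 := by omega
      rw [ballot_succ_succ, ballot_eq_zero_of_lt (by omega), ih (k := 0) (by omega)]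
      simp
    | succ k =>
      have p1 : ((n + 1 + 1).choose (k + 1) : ℤ) = (n + 1).choose k + (n + 1).choose (k + 1) := by
        exact_mod_cast Nat.choose_succ_succ (n + 1) k
      have p2 : ((n + 1).choose (k + 1) : ℤ) = n.choose k + n.choose (k + 1) := by
        exact_mod_cast Nat.choose_succ_succ n k
      cases a with
      | zero =>
        rw [ballot_succ_zero, ih (k := k) (by omega)]
        have p3 : n.choose k = n.choose (k + 1) := Nat.choose_symm_of_eq_add (by omega)
        rw [p1, p2, ← p3]
        ring
      | succ a =>
        rw [ballot_succ_succ, ih (k := k) (by omega), ih (k := k + 1) (by omega), p1, p2]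
        ring

/-- Paths can be reversed: `ballot n a`, defined by paths from `a` to `0`, also counts those from
`0` to `a`. Algebraically, the transfer operator is symmetric. -/
theorem iterate_pathTransfer_zero (n : ℕ) (F : ℕ → ℤ) :
    pathTransfer^[n] F 0 = ∑ a ∈ Finset.range (n + 1), ballot n a * F a := by
  induction n generalizing F with
  | zero => simp [ballot]
  | succ n ih =>
    rw [Function.iterate_succ_apply, ih, Finset.sum_range_succ' _ n,
      Finset.sum_range_succ' _ (n + 1), ballot_succ_zero]
    simp only [ballot_succ_succ, pathTransfer, mul_add, add_mul, Finset.sum_add_distrib]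
    -- Summation by parts: index shifts move the operator from `F` to `ballot`, and the upper
    -- boundary terms vanish since a path of length `n` descends by at most `n`.
    have h1 : ∑ a ∈ Finset.range (n + 1), ballot n a * F (a + 1) =
        ∑ a ∈ Finset.range n, ballot n (a + 1) * F (a + 2) + ballot n 0 * F 1 :=
      Finset.sum_range_succ' _ n
    have h2 : ∑ a ∈ Finset.range (n + 1), ballot n (a + 2) * F (a + 1) + ballot n 1 * F 0 =
        ∑ a ∈ Finset.range n, ballot n (a + 1) * F a := by
      rw [← Finset.sum_range_succ' (fun a => ballot n (a + 1) * F a) (n + 1),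
        Finset.sum_range_succ, Finset.sum_range_succ, ballot_eq_zero_of_lt (by omega),
        ballot_eq_zero_of_lt (by omega)]
      ring
    rw [h1]
    linarith

/-- Cut a Dyck path at its middle and sum over the height there. -/
theorem sum_ballot_sq (n : ℕ) :
    ∑ a ∈ Finset.range (n + 1), ballot n a * ballot n a = ballot (2 * n) 0 := by
  rw [← iterate_pathTransfer_zero, two_mul]
  simp only [ballot]
  rw [Function.iterate_add_apply]

theorem succ_mul_ballot_zero (n : ℕ) : ((n : ℤ) + 1) * ballot (2 * n) 0 = (2 * n).choose n := by
  rw [ballot_eq (k := n) (by omega)]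
  have h : (2 * n + 1).choose n * (n + 1) = (2 * n + 1) * (2 * n).choose n := by
    have := Nat.choose_mul_succ_eq (2 * n) n
    rw [show 2 * n + 1 - n = n + 1 by omega] at this
    linarith
  zify at h
  linear_combination -h

/-- The index `j` runs down from height `n` in steps of two, the only heights with the right parity.
The partial sums have a closed form, so the induction only checks one difference; the factor `n`
clears its denominator. -/
theorem sum_range_ballot {n k : ℕ} (hk : 2 * k ≤ n) :
    (n : ℤ) * ∑ j ∈ Finset.range (k + 1), ((n : ℤ) - 2 * j + 1) * ballot n (n - 2 * j) ^ 2 =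
      (((n : ℤ) - 2 * k) ^ 2 + n) * (n.choose k : ℤ) ^ 2 := by
  induction k with
  | zero =>
    rw [Finset.sum_range_one, ballot_eq (k := 0) (by omega)]
    simp; ring
  | succ k ih =>
    rw [Finset.sum_range_succ, mul_add, ih (by omega), ballot_eq (k := k + 1) (by omega)]
    have p1 : ((n + 1).choose (k + 1) : ℤ) = n.choose k + n.choose (k + 1) := by
      exact_mod_cast Nat.choose_succ_succ n k
    -- The ratio of consecutive binomial coefficients; the increment of the closed form is a
    -- multiple of this relation.
    have p2 : (n.choose (k + 1) : ℤ) * (k + 1) = n.choose k * (n - k) := by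
      have := Nat.choose_succ_right_eq n k
      zify [show k ≤ n by omega] at this
      exact this
    rw [p1]
    push_cast
    linear_combination -((4 * ((k : ℤ) + 1) - 2 * n) * n.choose (k + 1) +
      2 * (n - 2 * k) * n.choose k) * p2

theorem sum_range_even {f : ℕ → ℤ} (hf : ∀ a, Odd a → f a = 0) (M : ℕ) :
    ∑ a ∈ Finset.range (2 * M + 1), f a = ∑ j ∈ Finset.range (M + 1), f (2 * M - 2 * j) := by
  have h : ∑ a ∈ Finset.range (2 * M + 1), f a = ∑ j ∈ Finset.range (M + 1), f (2 * j) := by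
    induction M with
    | zero => simp
    | succ M ih =>
      rw [Finset.sum_range_succ _ (M + 1), ← ih, show 2 * (M + 1) + 1 = 2 * M + 1 + 1 + 1 by ring,
        Finset.sum_range_succ, Finset.sum_range_succ, hf _ ⟨M, rfl⟩]
      rw [add_zero]; congr 2
  rw [h, ← Finset.sum_range_reflect]
  refine Finset.sum_congr rfl fun j hj => ?_
  congr 1; omega

theorem sum_range_odd {f : ℕ → ℤ} (hf : ∀ a, Even a → f a = 0) (M : ℕ) :
    ∑ a ∈ Finset.range (2 * M + 2), f a = ∑ j ∈ Finset.range (M + 1), f (2 * M + 1 - 2 * j) := by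
  have h : ∑ a ∈ Finset.range (2 * M + 2), f a = ∑ j ∈ Finset.range (M + 1), f (2 * j + 1) := by
    induction M with
    | zero => simp [Finset.sum_range_succ, hf 0]
    | succ M ih =>
      rw [Finset.sum_range_succ _ (M + 1), ← ih, show 2 * (M + 1) + 2 = 2 * M + 2 + 1 + 1 by ring,
        Finset.sum_range_succ, Finset.sum_range_succ, hf _ ⟨M + 1, by ring⟩]
      rw [add_zero]; congr 2
  rw [h, ← Finset.sum_range_reflect]
  refine Finset.sum_congr rfl fun j hj => ?_
  have := Finset.mem_range.1 hj
  congr 1; omega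

theorem sum_succ_mul_ballot_sq_even {M : ℕ} (hM : 1 ≤ M) :
    ∑ a ∈ Finset.range (2 * M + 1), ((a : ℤ) + 1) * ballot (2 * M) a ^ 2 =
      ((2 * M).choose M : ℤ) ^ 2 := by
  rw [sum_range_even fun a ha => by
    rw [ballot_eq_zero_of_odd (by rw [Nat.odd_iff] at ha ⊢; omega)]; ring]
  have h := sum_range_ballot (n := 2 * M) (k := M) le_rfl
  have hn : ((2 * M : ℕ) : ℤ) ≠ 0 := by positivity
  refine mul_left_cancel₀ hn (Eq.trans ?_ (h.trans ?_))
  · congr 1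
    refine Finset.sum_congr rfl fun j hj => ?_
    have := Finset.mem_range.1 hj
    rw [Nat.cast_sub (by omega)]
    push_cast; ring
  · push_cast; ring

/-- At `n = 2M + 1`, `k = M` the closed form is `(2M + 2) * C(2M + 1, M)²`. One factor absorbs `(M +
1) / (2M + 1)` and becomes `C(2M, M)`, and twice the other is `C(2M + 2, M + 1)`. -/
theorem sum_succ_mul_ballot_sq_odd (M : ℕ) :
    ∑ a ∈ Finset.range (2 * M + 2), ((a : ℤ) + 1) * ballot (2 * M + 1) a ^ 2 =
      ((2 * M + 2).choose (M + 1) : ℤ) * ((2 * M).choose M : ℤ) := by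
  rw [sum_range_odd fun a ha => by
    rw [ballot_eq_zero_of_odd (by rw [Nat.even_iff] at ha; rw [Nat.odd_iff]; omega)]; ring]
  have h := sum_range_ballot (n := 2 * M + 1) (k := M) (by omega)
  have hn : ((2 * M + 1 : ℕ) : ℤ) ≠ 0 := by positivity
  refine mul_left_cancel₀ hn (Eq.trans ?_ (h.trans ?_))
  · congr 1
    refine Finset.sum_congr rfl fun j hj => ?_
    have := Finset.mem_range.1 hj
    rw [Nat.cast_sub (by omega)]
    push_cast; ring
  · have p1 : ((2 * M + 1).choose M : ℤ) * (M + 1) = (2 * M + 1) * (2 * M).choose M := by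
      have := Nat.choose_mul_succ_eq (2 * M) M
      rw [show 2 * M + 1 - M = M + 1 by omega] at this
      zify at this
      linarith
    have p2 : ((2 * M + 2).choose (M + 1) : ℤ) = 2 * (2 * M + 1).choose M := by
      have h1 := Nat.choose_succ_succ (2 * M + 1) M
      have h2 : (2 * M + 1).choose M = (2 * M + 1).choose (M + 1) :=
        Nat.choose_symm_of_eq_add (by omega)
      rw [← h2] at h1
      zify at h1
      rw [show 2 * M + 2 = (2 * M + 1).succ from rfl, show M + 1 = M.succ from rfl, h1]
      ring
    rw [p2]
    push_cast
    linear_combination 2 * ((2 * M + 1).choose M : ℤ) * p1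

end Counting

/-! ### Exact formulas for the average number of contact links -/

section Average

/-- The number of Dyck paths of length `2 * N`. -/
theorem card_isDyckPath (N : ℕ) :
    (Nat.card {w : Fin (2 * N) → Bool // IsDyckPath w} : ℤ) = ballot (2 * N) 0 := by
  classical
  rw [← sum_isPathFrom_one, Nat.card_eq_fintype_card, Fintype.card_subtype]
  simp only [isPathFrom_zero_iff, Finset.sum_boole]

/-- The sum of the mid-heights of the Dyck paths of length `2 * N`. -/
theorem sum_pathHeight_isDyckPath (N : ℕ)
    [Fintype {w : Fin (2 * N) → Bool // IsDyckPath w}] :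
    ∑ w : {w : Fin (2 * N) → Bool // IsDyckPath w}, pathHeight w.1 N =
      ∑ a ∈ Finset.range (N + 1), (a : ℤ) * ballot N a ^ 2 := by
  classical
  -- Splitting at the middle with the height as weight: both halves are counted by `ballot N a`,
  -- hence the square.
  have h := sum_isPathFrom id N N 0
  simp only [sum_isPathFrom_one] at h
  rw [iterate_pathTransfer_zero] at h
  have h2 : ∑ w : {w : Fin (2 * N) → Bool // IsDyckPath w}, pathHeight w.1 N =
      ∑ w : Fin (2 * N) → Bool, if IsDyckPath w then pathHeight w N else 0 := by
    rw [← Finset.sum_filter]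
    exact (Finset.sum_subtype (p := IsDyckPath) _ (by simp) fun w => pathHeight w N).symm
  rw [h2, two_mul]
  refine Eq.trans ?_ (h.trans ?_)
  · simp only [isPathFrom_zero_iff, id, Nat.cast_zero, zero_add]
  · exact Finset.sum_congr rfl fun a _ => by simp only [id]; ring

theorem rigidZ_eq {N : ℕ} (hN : 0 < N) : (rigidZ N : ℤ) = ballot (2 * N) 0 ^ 2 := by
  rw [rigidZ, Nat.card_congr (Equiv.ofBijective _ (RigidConfig.words_bijective N hN)),
    Nat.card_prod, Nat.cast_mul, card_isDyckPath, sq]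

/-- The two sides contribute equally, and while one mid-height is summed the other path ranges
freely over all Dyck paths. -/
theorem rigidY_eq {N : ℕ} (hN : 0 < N) : (rigidY N : ℤ) =
    2 * ballot (2 * N) 0 * ∑ a ∈ Finset.range (N + 1), (a : ℤ) * ballot N a ^ 2 := by
  classical
  have : Fintype (RigidConfig N) := Fintype.ofFinite _
  have : Fintype {w : Fin (2 * N) → Bool // IsDyckPath w} := Fintype.ofFinite _
  rw [rigidY, finsum_eq_sum_of_fintype, Nat.cast_sum]
  simp only [RigidConfig.contacts_eq hN]
  rw [(RigidConfig.words_bijective N hN).sum_comp fun p => pathHeight p.1.1 N + pathHeight p.2.1 N,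
    Fintype.sum_prod_type]
  simp only [Finset.sum_add_distrib, Finset.sum_const, Finset.card_univ, nsmul_eq_mul,
    ← Finset.mul_sum]
  rw [sum_pathHeight_isDyckPath, ← Nat.card_eq_fintype_card, card_isDyckPath]
  ring

/-- Replacing the weight `a` by `a + 1` makes the sum explicit. The correction is the sum of
squares, which is the Catalan number in the denominator, and so contributes exactly `-2`. -/
theorem rigidK_eq {N : ℕ} (hN : 0 < N) {P : ℤ}
    (hP : ∑ a ∈ Finset.range (N + 1), ((a : ℤ) + 1) * ballot N a ^ 2 = P) :
    rigidK N = 2 * (P : ℝ) / (1 / ((N : ℝ) + 1) * ((2 * N).choose N : ℝ)) - 2 := by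
  have h1 : ((N : ℝ) + 1) * (ballot (2 * N) 0 : ℝ) = (2 * N).choose N := by
    exact_mod_cast succ_mul_ballot_zero N
  have hc : ((2 * N).choose N : ℝ) ≠ 0 := by
    exact_mod_cast (Nat.choose_pos (by omega)).ne'
  have hb : (ballot (2 * N) 0 : ℝ) ≠ 0 := fun h => hc (by rw [← h1, h, mul_zero])
  have h2 : 1 / ((N : ℝ) + 1) * ((2 * N).choose N : ℝ) = ballot (2 * N) 0 := by
    rw [← h1]; field_simp
  have h3 : ∑ a ∈ Finset.range (N + 1), (a : ℤ) * ballot N a ^ 2 = P - ballot (2 * N) 0 := by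
    rw [← hP, ← sum_ballot_sq, ← Finset.sum_sub_distrib]
    exact Finset.sum_congr rfl fun a _ => by ring
  have hy : (rigidY N : ℝ) = 2 * ballot (2 * N) 0 * (P - ballot (2 * N) 0) := by
    have := rigidY_eq hN
    rw [h3] at this
    exact_mod_cast this
  have hz : (rigidZ N : ℝ) = (ballot (2 * N) 0 : ℝ) ^ 2 := by exact_mod_cast rigidZ_eq hN
  rw [rigidK, hy, hz, h2]
  field_simp

theorem rigidK_even {M : ℕ} (hM : 1 ≤ M) :
    rigidK (2 * M) = 2 * ((2 * M).choose M : ℝ) ^ 2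
      / ((1 / (2 * (M : ℝ) + 1)) * ((4 * M).choose (2 * M) : ℝ)) - 2 := by
  rw [rigidK_eq (by omega) (sum_succ_mul_ballot_sq_even hM), ← mul_assoc 2 2 M]
  push_cast
  rfl

theorem rigidK_odd {M : ℕ} (hM : 1 ≤ M) :
    rigidK (2 * M - 1) = 2 * ((2 * M).choose M : ℝ) * ((2 * M - 2).choose (M - 1) : ℝ)
      / ((1 / (2 * (M : ℝ))) * ((4 * M - 2).choose (2 * M - 1) : ℝ)) - 2 := by
  obtain ⟨M, rfl⟩ : ∃ m, M = m + 1 := ⟨M - 1, by omega⟩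
  rw [show 2 * (M + 1) - 1 = 2 * M + 1 by omega, show 2 * (M + 1) - 2 = 2 * M by omega,
    Nat.add_sub_cancel, show 4 * (M + 1) - 2 = 2 * (2 * M + 1) by omega,
    show 2 * (M + 1) = 2 * M + 2 by ring,
    rigidK_eq (by omega) (sum_succ_mul_ballot_sq_odd M)]
  push_cast
  rw [show (2 : ℝ) * M + 1 + 1 = 2 * (M + 1) by ring, mul_assoc 2 (((2 * M + 2).choose (M + 1)) : ℝ)]

end Average

/-! ### Asymptotics and uniqueness of the exponent -/

section AsymptoticBehaviour

theorem tendsto_atTop_of_even_of_odd {α : Type*} {f : ℕ → α} {l : Filter α}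
    (h0 : Tendsto (fun m => f (2 * m)) atTop l) (h1 : Tendsto (fun m => f (2 * m + 1)) atTop l) :
    Tendsto f atTop l := by
  intro U hU
  obtain ⟨a, ha⟩ := eventually_atTop.1 (h0.eventually hU)
  obtain ⟨b, hb⟩ := eventually_atTop.1 (h1.eventually hU)
  refine eventually_atTop.2 ⟨2 * (a + b), fun n hn => ?_⟩
  rcases Nat.even_or_odd' n with ⟨k, rfl | rfl⟩
  · exact ha k (by omega)
  · exact hb k (by omega)

/-- Central binomial coefficients divided by the leading term of their asymptotic expansion, up to
the factor `√π`. -/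
noncomputable def centralRatio (n : ℕ) : ℝ := ((2 * n).choose n : ℝ) * √(n : ℝ) / 4 ^ n

/-- In the quotient of Stirling sequences the powers of `n / e` cancel up to `4 ^ n`. As each
sequence tends to `√π`, the ratio tends to `√π / π`. -/
theorem centralRatio_eq {n : ℕ} (hn : 0 < n) :
    centralRatio n = Stirling.stirlingSeq (2 * n) / Stirling.stirlingSeq n ^ 2 := by
  have hn' : (0 : ℝ) < n := by exact_mod_cast hn
  have h1 : ((2 * n).choose n : ℝ) = ((2 * n).factorial : ℝ) / ((n.factorial : ℝ) ^ 2) := by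
    rw [Nat.cast_choose ℝ (by omega : n ≤ 2 * n), show 2 * n - n = n by omega, sq]
  have hf : (n.factorial : ℝ) ≠ 0 := by exact_mod_cast n.factorial_ne_zero
  have h2 : √(2 * ((2 * n : ℕ) : ℝ)) = 2 * √(n : ℝ) := by
    rw [show 2 * ((2 * n : ℕ) : ℝ) = 2 ^ 2 * n by push_cast; ring, Real.sqrt_mul (by norm_num),
      Real.sqrt_sq (by norm_num)]
  have h3 : √(2 * (n : ℝ)) ^ 2 = 2 * √(n : ℝ) ^ 2 := by
    rw [Real.sq_sqrt (by positivity), Real.sq_sqrt (by positivity)]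
  have h4 : ((2 * n : ℕ) / Real.exp 1 : ℝ) ^ (2 * n) = 4 ^ n * ((n / Real.exp 1 : ℝ) ^ n) ^ 2 := by
    rw [← pow_mul, mul_comm n 2, pow_mul, pow_mul, ← mul_pow]
    congr 1
    push_cast; ring
  have hs : √(n : ℝ) ≠ 0 := (Real.sqrt_pos.2 hn').ne'
  have he : ((n / Real.exp 1 : ℝ) ^ n) ≠ 0 := by positivity
  rw [centralRatio, Stirling.stirlingSeq, Stirling.stirlingSeq, h1, h2, h4]
  generalize (n / Real.exp 1 : ℝ) ^ n = e at he ⊢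
  rw [div_pow, mul_pow, h3]
  field_simp

theorem tendsto_centralRatio : Tendsto centralRatio atTop (𝓝 (1 / √Real.pi)) := by
  have h := Stirling.tendsto_stirlingSeq_sqrt_pi
  have hpi : √Real.pi ≠ 0 := (Real.sqrt_pos.2 Real.pi_pos).ne'
  have h2 : Tendsto (fun n : ℕ => Stirling.stirlingSeq (2 * n)) atTop (𝓝 (√Real.pi)) :=
    h.comp (tendsto_id.const_mul_atTop' two_pos)
  have h3 := h2.div (h.pow 2) (pow_ne_zero 2 hpi)
  rw [show √Real.pi / √Real.pi ^ 2 = 1 / √Real.pi by field_simp] at h3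
  refine h3.congr' ?_
  filter_upwards [eventually_gt_atTop 0] with n hn
  rw [centralRatio_eq hn]
  rfl

theorem choose_eq_centralRatio {n : ℕ} (hn : 0 < n) :
    ((2 * n).choose n : ℝ) = centralRatio n * 4 ^ n / √(n : ℝ) := by
  have hn' : (0 : ℝ) < n := by exact_mod_cast hn
  have hs : √(n : ℝ) ≠ 0 := (Real.sqrt_pos.2 hn').ne'
  rw [centralRatio]
  field_simp

theorem centralRatio_ne_zero {n : ℕ} (hn : 0 < n) : centralRatio n ≠ 0 := by
  have hn' : (0 : ℝ) < n := by exact_mod_cast hn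
  have h : (0 : ℝ) < (2 * n).choose n := by exact_mod_cast Nat.choose_pos (by omega)
  have := Real.sqrt_pos.2 hn'
  unfold centralRatio
  positivity

theorem rigidK_even_div_sqrt {M : ℕ} (hM : 0 < M) : rigidK (2 * M) / √((2 * M : ℕ) : ℝ) =
    2 * (centralRatio M ^ 2 / centralRatio (2 * M)) * (2 + 1 / (M : ℝ))
      - 2 / √((2 * M : ℕ) : ℝ) := by
  have hM' : (0 : ℝ) < M := by exact_mod_cast hM
  have hN' : (0 : ℝ) < (2 * M : ℕ) := by exact_mod_cast (by omega : 0 < 2 * M)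
  have hs := (Real.sqrt_pos.2 hM').ne'
  have ht := (Real.sqrt_pos.2 hN').ne'
  have hc := centralRatio_ne_zero (show 0 < 2 * M by omega)
  have h2 : √(M : ℝ) ^ 2 = M := Real.sq_sqrt hM'.le
  rw [rigidK_even hM, show 4 * M = 2 * (2 * M) by ring, choose_eq_centralRatio hM,
    choose_eq_centralRatio (show 0 < 2 * M by omega), pow_mul 4 2 M, sub_div]
  congr 1
  rw [div_pow, h2, mul_pow, ← pow_mul 4 M 2, mul_comm M 2, pow_mul]
  field_simp

theorem rigidK_odd_div_sqrt {M : ℕ} (hM : 0 < M) : rigidK (2 * M + 1) / √((2 * M + 1 : ℕ) : ℝ) =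
    2 * (centralRatio (M + 1) * centralRatio M / centralRatio (2 * M + 1)) *
      (2 * √(1 + 1 / (M : ℝ))) - 2 / √((2 * M + 1 : ℕ) : ℝ) := by
  have hM' : (0 : ℝ) < M := by exact_mod_cast hM
  have hM1 : (0 : ℝ) < (M + 1 : ℕ) := by exact_mod_cast M.succ_pos
  have hN' : (0 : ℝ) < (2 * M + 1 : ℕ) := by exact_mod_cast (2 * M).succ_pos
  have hs := (Real.sqrt_pos.2 hM').ne'
  have hs1 := (Real.sqrt_pos.2 hM1).ne'
  have ht := (Real.sqrt_pos.2 hN').ne'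
  have hc := centralRatio_ne_zero (show 0 < 2 * M + 1 by omega)
  have h1 : √(1 + 1 / (M : ℝ)) = √((M + 1 : ℕ) : ℝ) / √(M : ℝ) := by
    rw [← Real.sqrt_div hM1.le]
    congr 1
    push_cast; field_simp
  have h2 : 2 * ((M + 1 : ℕ) : ℝ) = 2 * √((M + 1 : ℕ) : ℝ) ^ 2 := by rw [Real.sq_sqrt hM1.le]
  have hk := rigidK_odd (show 1 ≤ M + 1 by omega)
  rw [show 2 * (M + 1) - 1 = 2 * M + 1 by omega, show 2 * (M + 1) - 2 = 2 * M by omega,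
    Nat.add_sub_cancel, show 4 * (M + 1) - 2 = 2 * (2 * M + 1) by omega,
    choose_eq_centralRatio hM, choose_eq_centralRatio (show 0 < M + 1 by omega),
    choose_eq_centralRatio (show 0 < 2 * M + 1 by omega), h2] at hk
  rw [hk, h1, sub_div]
  congr 1
  rw [show (4 : ℝ) ^ (2 * M + 1) = 4 ^ (M + 1) * 4 ^ M by rw [← pow_add]; congr 1; ring]
  field_simp

/-- For both parities the powers of `4` cancel. The three central ratios combine to `1 / √π`, and
the remaining factors tend to `2 * 2`, while the `-2` disappears after division by `√N`. -/
theorem tendsto_rigidK_div_sqrt :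
    Tendsto (fun N : ℕ => rigidK N / √(N : ℝ)) atTop (𝓝 (4 / √Real.pi)) := by
  have hpi : √Real.pi ≠ 0 := (Real.sqrt_pos.2 Real.pi_pos).ne'
  have hc := tendsto_centralRatio
  have hlim : 1 / √Real.pi ≠ 0 := one_div_ne_zero hpi
  have he : Tendsto (fun m : ℕ => 2 * m) atTop atTop := tendsto_id.const_mul_atTop' two_pos
  have ho : Tendsto (fun m : ℕ => 2 * m + 1) atTop atTop := 
    (tendsto_add_atTop_nat 1).comp he
  have hinv : Tendsto (fun m : ℕ => 1 / (m : ℝ)) atTop (𝓝 0) := tendsto_one_div_atTop_nhds_zero_nat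
  have hsq : Tendsto (fun n : ℕ => 2 / √(n : ℝ)) atTop (𝓝 0) :=
    tendsto_const_nhds.div_atTop (Real.tendsto_sqrt_atTop.comp tendsto_natCast_atTop_atTop)
  refine tendsto_atTop_of_even_of_odd ?_ ?_
  · have h := ((((hc.pow 2).div (hc.comp he) hlim).const_mul 2).mul (hinv.const_add 2)).sub
      (hsq.comp he)
    rw [show 2 * ((1 / √Real.pi) ^ 2 / (1 / √Real.pi)) * (2 + 0) - 0 = 4 / √Real.pi by
      field_simp; norm_num] at h
    refine h.congr' ?_
    filter_upwards [eventually_gt_atTop 0] with M hM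
    exact (rigidK_even_div_sqrt hM).symm
  · have hr : Tendsto (fun m : ℕ => 2 * √(1 + 1 / (m : ℝ))) atTop (𝓝 (2 * √(1 + 0))) :=
      ((hinv.const_add 1).sqrt).const_mul 2
    have h := (((((hc.comp (tendsto_add_atTop_nat 1)).mul hc).div (hc.comp ho) hlim).const_mul
      2).mul hr).sub (hsq.comp ho)
    rw [show 2 * (1 / √Real.pi * (1 / √Real.pi) / (1 / √Real.pi)) * (2 * √(1 + 0)) - 0 =
      4 / √Real.pi by rw [add_zero, Real.sqrt_one]; field_simp; norm_num] at h
    refine h.congr' ?_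
    filter_upwards [eventually_gt_atTop 0] with M hM
    exact (rigidK_odd_div_sqrt hM).symm

theorem rigidK_isEquivalent :
    rigidK ~[atTop] fun N : ℕ => 4 * Real.sqrt ((N : ℝ) / Real.pi) := by
  have hpi : √Real.pi ≠ 0 := (Real.sqrt_pos.2 Real.pi_pos).ne'
  refine isEquivalent_of_tendsto_one ?_
  have h := tendsto_rigidK_div_sqrt.div_const (4 / √Real.pi)
  rw [div_self (by positivity)] at h
  refine h.congr' (Eventually.of_forall fun N => ?_)
  simp only [Pi.div_apply]
  rw [Real.sqrt_div (Nat.cast_nonneg N), div_div]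
  congr 1
  ring

theorem isEquivalent_rpow_iff {u : ℕ → ℝ} {c μ : ℝ} (hc : 0 < c)
    (hu : Tendsto (fun N : ℕ => u N / (N : ℝ) ^ μ) atTop (𝓝 c)) (ν : ℝ) :
    (∃ ϱ : ℝ, 0 < ϱ ∧ u ~[atTop] fun N : ℕ => ϱ * (N : ℝ) ^ ν) ↔ ν = μ := by
  have hpos : ∀ᶠ N : ℕ in atTop, (0 : ℝ) < N := by
    filter_upwards [eventually_gt_atTop 0] with N hN
    exact_mod_cast hN
  constructor
  · rintro ⟨ϱ, hϱ, h⟩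
    have h1 : Tendsto (fun N : ℕ => u N / (ϱ * (N : ℝ) ^ ν)) atTop (𝓝 1) :=
      (isEquivalent_iff_tendsto_one (by
        filter_upwards [hpos] with N hN
        positivity)).1 h
    -- Comparing the two growth laws gives this power a finite positive limit. A negative exponent
    -- would give limit `0`, and a positive one would diverge.
    have h2 : Tendsto (fun N : ℕ => (N : ℝ) ^ (ν - μ)) atTop (𝓝 (c / ϱ)) := by
      have h3 := (hu.div h1 one_ne_zero).div_const ϱ
      rw [div_one] at h3
      refine h3.congr' ?_
      have hu0 : ∀ᶠ N : ℕ in atTop, u N / (N : ℝ) ^ μ ≠ 0 := hu.eventually_ne hc.ne'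
      filter_upwards [hpos, hu0] with N hN hN0
      have hu1 : u N ≠ 0 := fun e => hN0 (by rw [e, zero_div])
      have a1 : (N : ℝ) ^ μ ≠ 0 := (Real.rpow_pos_of_pos hN μ).ne'
      rw [Real.rpow_sub hN, Pi.div_apply]
      field_simp
    rcases lt_trichotomy ν μ with hlt | heq | hgt
    · have h3 := (tendsto_rpow_neg_atTop (sub_pos.2 hlt)).comp (tendsto_natCast_atTop_atTop (R := ℝ))
      rw [neg_sub] at h3
      exact absurd (tendsto_nhds_unique h2 h3) (div_pos hc hϱ).ne'
    · exact heq
    · have h3 := (tendsto_rpow_atTop (sub_pos.2 hgt)).comp (tendsto_natCast_atTop_atTop (R := ℝ))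
      exact absurd h2 (not_tendsto_nhds_of_tendsto_atTop h3 _)
  · rintro rfl
    refine ⟨c, hc, isEquivalent_of_tendsto_one ?_⟩
    have h := hu.div_const c
    rw [div_self hc.ne'] at h
    refine h.congr fun N => ?_
    rw [Pi.div_apply, div_div, mul_comm c]

end AsymptoticBehaviour

/-! ### The exact formulas, the equivalent and the exponent together -/

theorem mainTheorem3 :
    (∀ M : ℕ, 1 ≤ M →
      rigidK (2 * M) =
        2 * ((2 * M).choose M : ℝ) ^ 2
            / ((1 / (2 * (M : ℝ) + 1)) * ((4 * M).choose (2 * M) : ℝ)) - 2) ∧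
    (∀ M : ℕ, 1 ≤ M →
      rigidK (2 * M - 1) =
        2 * ((2 * M).choose M : ℝ) * ((2 * M - 2).choose (M - 1) : ℝ)
            / ((1 / (2 * (M : ℝ))) * ((4 * M - 2).choose (2 * M - 1) : ℝ)) - 2) ∧
    (rigidK ~[atTop] fun N : ℕ => 4 * Real.sqrt ((N : ℝ) / Real.pi)) ∧
    (∀ ν : ℝ,
      (∃ ϱ : ℝ, 0 < ϱ ∧ rigidK ~[atTop] fun N : ℕ => ϱ * (N : ℝ) ^ ν) ↔ ν = 1 / 2) := by
  refine ⟨fun M => rigidK_even, fun M => rigidK_odd, rigidK_isEquivalent, fun ν => ?_⟩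
  refine isEquivalent_rpow_iff (c := 4 / √Real.pi)
    (div_pos (by norm_num) (Real.sqrt_pos.2 Real.pi_pos)) ?_ ν
  simpa only [← Real.sqrt_eq_rpow] using tendsto_rigidK_div_sqrt
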